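/- Let $k$ be a commutative unital ring and let $\lambda\in k$ be invertible, $\lambda\neq 1$. Put $B=k[x,\tfrac1x,\tfrac1{x-1}]$ and $A=k[x,\tfrac1x,\tfrac1{x-1},\tfrac1{x-\lambda}]$, and let $\mathbb A$ be the diagram $f,g:B\rightrightarrows A$ of $k$-algebras in which $f(x)=x$ and $g(x)=\lambda^{-1}x$. Let $H^2(\mathbb A,\mathbb A)$ be its second diagram cohomology: an $n$-cochain is a quadruple $\Gamma=(\Gamma^B,\Gamma^A,\Gamma^f,\Gamma^g)$ of a Hochschild $n$-cochain of $B$ in $B$, one of $A$ in $A$, and two $(n-1)$-cochains of $B$ in $A$ ($A$ being a $B$-bimodule through $f$, respectively $g$), with coboundary $\delta\Gamma=(\delta\Gamma^B,\ \delta\Gamma^A,\ f\Gamma^B-\Gamma^Af-\delta\Gamma^f,\ g\Gamma^B-\Gamma^Ag-\delta\Gamma^g)$. 1. Every class in $H^2(\mathbb A,\mathbb A)$ is represented by a cocycle $(0,0,\Gamma^f,\Gamma^g)$ with $\Gamma^f,\Gamma^g:B\to A$ derivations along $f$ and $g$, and $(0,0,\Gamma^f,\Gamma^g)\mapsto \Gamma^f(x)-\lambda\Gamma^g(x)$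 induces an isomorphism of $k$-modules $$H^2(\mathbb A,\mathbb A)\;\cong\; A\,/\,\{\,b(x)-\lambda\, b(\lambda^{-1}x) : b\in B\,\}.$$ 2. $H^2(\mathbb A,\mathbb A)$ is not a finitely generated $k$-module; in particular it is infinite-dimensional if $k$ is a field. 3. Suppose moreover that $1-\lambda^n$ is invertible in $k$ for every $n\ge 1$ (if $k$ is a field: $\lambda$ is not a root of unity). Then $H^2(\mathbb A,\mathbb A)$ is a free $k$-module, with basis the classes of the cocycles $(0,0,\Gamma^f,0)$ with $\Gamma^f(x)=x$ (one element) and with $\Gamma^f(x)=1/(x-1)^N$, $N=1,2,3,\dots$ (an infinite family). 4. Under the assumption of 3, call a derivation in the diagram (of $B$, of $A$, or from $B$ to $A$ along $f$ or $g$) regular if its value at $x$ is regular at the points $1$ and $\lambda$, i.e. at each of these points $c$ it can be written as $p/q$ with $p,q\in k[x]$ and $q(c)$ invertible. Then the cocycles $(0,0,\Gamma^f,\Gamma^g)$ with $\Gamma^f,\Gamma^g$ regular, modulo the coboundaries $(0,0,f\gamma^B-\gamma^Af,\ g\gamma^B-\gamma^Ag)$ of regular derivations $\gamma^B,\gamma^A$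 of $B$ and $A$, map injectively into $H^2(\mathbb A,\mathbb A)$, and the image is the free module of rank one spanned by the class of $x$: the infinite family is eliminated. -/

import Mathlib

set_option maxSynthPendingDepth 3

open Polynomial

/-! ### Hochschild cochains in low degree and the cohomology of a parallel pair of algebra maps -/

namespace DiagramCohomology

section Hochschild

variable {k B A : Type*} [CommRing k] [Ring B] [Algebra k B] [Ring A] [Algebra k A]

/-- Hochschild 1-cochains of `B` with coefficients in `A`. -/
abbrev Cochain1 (k B A : Type*) [CommRing k] [Ring B] [Algebra k B] [Ring A] [Algebra k A] :=
  B →ₗ[k] A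

/-- Hochschild 2-cochains of `B` with coefficients in `A`. -/
abbrev Cochain2 (k B A : Type*) [CommRing k] [Ring B] [Algebra k B] [Ring A] [Algebra k A] :=
  B →ₗ[k] B →ₗ[k] A

/-- Hochschild 3-cochains of `B` with coefficients in `A`. -/
abbrev Cochain3 (k B A : Type*) [CommRing k] [Ring B] [Algebra k B] [Ring A] [Algebra k A] :=
  B →ₗ[k] B →ₗ[k] B →ₗ[k] A

/-- The Hochschild coboundary of a 0-cochain `m : A` of `B` with coefficients in `A`, which is a
`B`-bimodule through `φ`:  `b ↦ φ b * m - m * φ b`. -/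
def hoch0 (φ : B →ₐ[k] A) : A →ₗ[k] Cochain1 k B A :=
  LinearMap.mk₂ k (fun m b => φ b * m - m * φ b)
    (fun m m' b => by simp only [mul_add, add_mul]; abel)
    (fun c m b => by simp only [mul_smul_comm, smul_mul_assoc, smul_sub])
    (fun m b b' => by simp only [map_add, mul_add, add_mul]; abel)
    (fun c m b => by simp only [map_smul, mul_smul_comm, smul_mul_assoc, smul_sub])

/-- The Hochschild coboundary of a 1-cochain:
`(b, b') ↦ φ b * D b' - D (b * b') + D b * φ b'`. -/
def hoch1 (φ : B →ₐ[k] A) : Cochain1 k B A →ₗ[k] Cochain2 k B A where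
  toFun D := LinearMap.mk₂ k (fun b b' => φ b * D b' - D (b * b') + D b * φ b')
    (fun b₁ b₂ b' => by simp only [map_add, add_mul]; abel)
    (fun c b b' => by
      simp only [map_smul, smul_mul_assoc, smul_sub, smul_add])
    (fun b b₁ b₂ => by simp only [map_add, mul_add]; abel)
    (fun c b b' => by
      simp only [map_smul, mul_smul_comm, smul_sub, smul_add])
  map_add' D D' := by
    ext b b'
    simp only [LinearMap.mk₂_apply, LinearMap.add_apply, mul_add, add_mul]; abel
  map_smul' c D := by
    ext b b'
    simp only [LinearMap.mk₂_apply, LinearMap.smul_apply, RingHom.id_apply, mul_smul_comm,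
      smul_mul_assoc, smul_sub, smul_add]

/-- The Hochschild coboundary of a 2-cochain:
`(a, b, c) ↦ φ a * F b c - F (a * b) c + F a (b * c) - F a b * φ c`. -/
def hoch2 (φ : B →ₐ[k] A) : Cochain2 k B A →ₗ[k] Cochain3 k B A where
  toFun F := LinearMap.mk₂ k
    (fun a b =>
      (LinearMap.mulLeft k (φ a)) ∘ₗ (F b) - F (a * b) + (F a) ∘ₗ (LinearMap.mulLeft k b)
        - (LinearMap.mulLeft k (F a b)) ∘ₗ φ.toLinearMap)
    (fun a a' b => by
      ext c
      simp [add_mul]; abel)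
    (fun r a b => by
      ext c
      simp [smul_sub, smul_add])
    (fun a b b' => by
      ext c
      simp [add_mul, mul_add]; abel)
    (fun r a b => by
      ext c
      simp [smul_sub, smul_add])
  map_add' F G := by
    ext a b c
    simp [add_mul, mul_add]; abel
  map_smul' r F := by
    ext a b c
    simp [smul_sub, smul_add]

@[simp] theorem hoch0_apply (φ : B →ₐ[k] A) (m : A) (b : B) :
    hoch0 φ m b = φ b * m - m * φ b := rfl

@[simp] theorem hoch1_apply (φ : B →ₐ[k] A) (D : Cochain1 k B A) (b b' : B) :
    hoch1 φ D b b' = φ b * D b' - D (b * b') + D b * φ b' := rfl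

@[simp] theorem hoch2_apply (φ : B →ₐ[k] A) (F : Cochain2 k B A) (a b c : B) :
    hoch2 φ F a b c = φ a * F b c - F (a * b) c + F a (b * c) - F a b * φ c := rfl

/-- `k`-linear derivations of `B` into `A`, along the algebra map `φ`. -/
def Der (φ : B →ₐ[k] A) : Submodule k (B →ₗ[k] A) where
  carrier := {D | ∀ b b', D (b * b') = φ b * D b' + D b * φ b'}
  zero_mem' := by intro b b'; simp
  add_mem' := by
    intro D D' h h' b b'
    simp only [LinearMap.add_apply, h b b', h' b b', mul_add, add_mul]; abel
  smul_mem' := by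
    intro c D h b b'
    simp only [LinearMap.smul_apply, h b b', smul_add, mul_smul_comm, smul_mul_assoc]

theorem hoch1_eq_zero_iff (φ : B →ₐ[k] A) (D : B →ₗ[k] A) : hoch1 φ D = 0 ↔ D ∈ Der φ := by
  constructor
  · intro h b b'
    have h1 : hoch1 φ D b b' = 0 := by rw [h]; rfl
    rw [hoch1_apply] at h1
    have h2 : D (b * b') = φ b * D b' + D b * φ b'
        - (φ b * D b' - D (b * b') + D b * φ b') := by abel
    rw [h1, sub_zero] at h2
    exact h2
  · intro h
    ext b b'
    rw [hoch1_apply, h b b']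
    simp only [LinearMap.zero_apply]; abel

end Hochschild

section Pair

variable {k B A : Type*} [CommRing k] [Ring B] [Algebra k B] [Ring A] [Algebra k A]

/-- 1-cochains `(γ^B, γ^A, γ^f, γ^g)` of the diagram `B ⇉ A`. -/
abbrev C1 (k B A : Type*) [CommRing k] [Ring B] [Algebra k B] [Ring A] [Algebra k A] :=
  Cochain1 k B B × Cochain1 k A A × A × A

/-- 2-cochains `(Γ^B, Γ^A, Γ^f, Γ^g)` of the diagram `B ⇉ A`. -/
abbrev C2 (k B A : Type*) [CommRing k] [Ring B] [Algebra k B] [Ring A] [Algebra k A] :=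
  Cochain2 k B B × Cochain2 k A A × Cochain1 k B A × Cochain1 k B A

/-- 3-cochains of the diagram `B ⇉ A`. -/
abbrev C3 (k B A : Type*) [CommRing k] [Ring B] [Algebra k B] [Ring A] [Algebra k A] :=
  Cochain3 k B B × Cochain3 k A A × Cochain2 k B A × Cochain2 k B A

/-- The simplicial part of the coboundary in degree one: `φ ∘ γ^B - γ^A ∘ φ`. -/
def simp1 (φ : B →ₐ[k] A) : Cochain1 k B B × Cochain1 k A A →ₗ[k] Cochain1 k B A where
  toFun p := φ.toLinearMap ∘ₗ p.1 - p.2 ∘ₗ φ.toLinearMap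
  map_add' p q := by ext b; simp; abel
  map_smul' c p := by ext b; simp [smul_sub]

/-- The simplicial part of the coboundary in degree two: `φ Γ^B(b, b') - Γ^A(φ b, φ b')`. -/
def simp2 (φ : B →ₐ[k] A) : Cochain2 k B B × Cochain2 k A A →ₗ[k] Cochain2 k B A where
  toFun p := p.1.compr₂ φ.toLinearMap - p.2.compl₁₂ φ.toLinearMap φ.toLinearMap
  map_add' p q := by ext b b'; simp; abel
  map_smul' c p := by ext b b'; simp [smul_sub]

@[simp] theorem simp1_apply (φ : B →ₐ[k] A) (p : Cochain1 k B B × Cochain1 k A A) (b : B) :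
    simp1 φ p b = φ (p.1 b) - p.2 (φ b) := rfl

@[simp] theorem simp2_apply (φ : B →ₐ[k] A) (p : Cochain2 k B B × Cochain2 k A A) (b b' : B) :
    simp2 φ p b b' = φ (p.1 b b') - p.2 (φ b) (φ b') := rfl

/-- The coboundary `C¹ → C²` of the diagram `f, g : B ⇉ A`. -/
def d1 (f g : B →ₐ[k] A) : C1 k B A →ₗ[k] C2 k B A where
  toFun γ := (hoch1 (AlgHom.id k B) γ.1, hoch1 (AlgHom.id k A) γ.2.1,
    simp1 f (γ.1, γ.2.1) - hoch0 f γ.2.2.1, simp1 g (γ.1, γ.2.1) - hoch0 g γ.2.2.2)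
  map_add' γ γ' := by
    have h (φ : B →ₐ[k] A) : simp1 φ (γ.1 + γ'.1, γ.2.1 + γ'.2.1)
      = simp1 φ (γ.1, γ.2.1) + simp1 φ (γ'.1, γ'.2.1) := (simp1 φ).map_add (γ.1, γ.2.1) (γ'.1, γ'.2.1)
    simp only [Prod.fst_add, Prod.snd_add, map_add, h, Prod.mk_add_mk, add_sub_add_comm]
  map_smul' c γ := by
    have h (φ : B →ₐ[k] A) : simp1 φ (c • γ.1, c • γ.2.1)
      = c • simp1 φ (γ.1, γ.2.1) := (simp1 φ).map_smul c (γ.1, γ.2.1)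
    simp only [Prod.smul_fst, Prod.smul_snd, map_smul, h, Prod.smul_mk, smul_sub, RingHom.id_apply]

/-- The coboundary `C² → C³` of the diagram `f, g : B ⇉ A`. -/
def d2 (f g : B →ₐ[k] A) : C2 k B A →ₗ[k] C3 k B A where
  toFun Γ := (hoch2 (AlgHom.id k B) Γ.1, hoch2 (AlgHom.id k A) Γ.2.1,
    simp2 f (Γ.1, Γ.2.1) - hoch1 f Γ.2.2.1, simp2 g (Γ.1, Γ.2.1) - hoch1 g Γ.2.2.2)
  map_add' γ γ' := by
    have h (φ : B →ₐ[k] A) : simp2 φ (γ.1 + γ'.1, γ.2.1 + γ'.2.1)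
      = simp2 φ (γ.1, γ.2.1) + simp2 φ (γ'.1, γ'.2.1) := (simp2 φ).map_add (γ.1, γ.2.1) (γ'.1, γ'.2.1)
    simp only [Prod.fst_add, Prod.snd_add, map_add, h, Prod.mk_add_mk, add_sub_add_comm]
  map_smul' c γ := by
    have h (φ : B →ₐ[k] A) : simp2 φ (c • γ.1, c • γ.2.1)
      = c • simp2 φ (γ.1, γ.2.1) := (simp2 φ).map_smul c (γ.1, γ.2.1)
    simp only [Prod.smul_fst, Prod.smul_snd, map_smul, h, Prod.smul_mk, smul_sub, RingHom.id_apply]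

/-- The sequence `C¹ → C² → C³` is a complex. -/
theorem d2_comp_d1 (f g : B →ₐ[k] A) : d2 f g ∘ₗ d1 f g = 0 := by
  have hh (φ : B →ₐ[k] A) (γB : Cochain1 k B B) (γA : Cochain1 k A A) (m : A) (b b' : B) :
      φ (b * γB b' - γB (b * b') + γB b * b') -
        (φ b * γA (φ b') - γA (φ b * φ b') + γA (φ b) * φ b') -
      (φ b * (φ (γB b') - γA (φ b') - (φ b' * m - m * φ b'))
        - (φ (γB (b * b')) - γA (φ (b * b')) - (φ (b * b') * m - m * φ (b * b')))
        + (φ (γB b) - γA (φ b) - (φ b * m - m * φ b)) * φ b') = 0 := by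
    simp only [map_add, map_sub, map_mul]; noncomm_ring
  apply LinearMap.ext
  rintro ⟨γB, γA, mf, mg⟩
  refine Prod.ext ?_ (Prod.ext ?_ (Prod.ext ?_ ?_))
  · apply LinearMap.ext; intro a; apply LinearMap.ext; intro b; apply LinearMap.ext; intro c
    simp only [d2, d1, LinearMap.comp_apply, LinearMap.coe_mk, AddHom.coe_mk, hoch2_apply,
      hoch1_apply, AlgHom.coe_id, id_eq, LinearMap.zero_apply, Prod.fst_zero]
    noncomm_ring
  · apply LinearMap.ext; intro a; apply LinearMap.ext; intro b; apply LinearMap.ext; intro c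
    simp only [d2, d1, LinearMap.comp_apply, LinearMap.coe_mk, AddHom.coe_mk, hoch2_apply,
      hoch1_apply, AlgHom.coe_id, id_eq, LinearMap.zero_apply, Prod.fst_zero, Prod.snd_zero]
    noncomm_ring
  · apply LinearMap.ext; intro b; apply LinearMap.ext; intro b'
    exact hh f γB γA mf b b'
  · apply LinearMap.ext; intro b; apply LinearMap.ext; intro b'
    exact hh g γB γA mg b b'

/-- The second cohomology of the diagram `f, g : B ⇉ A` with coefficients in itself. -/
abbrev H2 (f g : B →ₐ[k] A) :=
  LinearMap.ker (d2 f g) ⧸ (LinearMap.range (d1 f g)).comap (LinearMap.ker (d2 f g)).subtype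

/-- A pair of derivations `(Γ^f, Γ^g)` gives the 2-cocycle `(0, 0, Γ^f, Γ^g)`. -/
def derCocycle (f g : B →ₐ[k] A) : (Der f × Der g) →ₗ[k] LinearMap.ker (d2 f g) where
  toFun p := ⟨(0, 0, p.1.1, p.2.1), by
    have h1 := (hoch1_eq_zero_iff f p.1.1).2 p.1.2
    have h2 := (hoch1_eq_zero_iff g p.2.1).2 p.2.2
    have h0 (φ : B →ₐ[k] A) : simp2 φ (0, 0) = 0 := (simp2 φ).map_zero
    simp only [LinearMap.mem_ker, d2, LinearMap.coe_mk, AddHom.coe_mk, map_zero, h0, h1, h2,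
      sub_zero]
    rfl⟩
  map_add' p q := by ext1; simp
  map_smul' c p := by ext1; simp

/-- The cohomology class of the 2-cocycle `(0, 0, Γ^f, Γ^g)`. -/
def derClass (f g : B →ₐ[k] A) : (Der f × Der g) →ₗ[k] H2 f g :=
  Submodule.mkQ _ ∘ₗ derCocycle f g

theorem simp1_mem_der (φ : B →ₐ[k] A) {γB : B →ₗ[k] B} {γA : A →ₗ[k] A}
    (hB : γB ∈ Der (AlgHom.id k B)) (hA : γA ∈ Der (AlgHom.id k A)) :
    simp1 φ (γB, γA) ∈ Der φ := by
  intro b b'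
  have e1 := hB b b'
  have e2 := hA (φ b) (φ b')
  simp only [AlgHom.coe_id, id_eq] at e1 e2
  simp only [simp1_apply, map_mul, e1, e2, map_add]
  noncomm_ring

/-- The coboundary of a pair of derivations `γ^B`, `γ^A`:
the pair `(f γ^B - γ^A f, g γ^B - γ^A g)`. -/
def derCoboundary (f g : B →ₐ[k] A) :
    (Der (AlgHom.id k B) × Der (AlgHom.id k A)) →ₗ[k] (Der f × Der g) where
  toFun p := (⟨simp1 f (p.1.1, p.2.1), simp1_mem_der f p.1.2 p.2.2⟩,
    ⟨simp1 g (p.1.1, p.2.1), simp1_mem_der g p.1.2 p.2.2⟩)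
  map_add' p q := Prod.ext
    (Subtype.ext ((simp1 f).map_add (p.1.1, p.2.1) (q.1.1, q.2.1)))
    (Subtype.ext ((simp1 g).map_add (p.1.1, p.2.1) (q.1.1, q.2.1)))
  map_smul' c p := Prod.ext
    (Subtype.ext ((simp1 f).map_smul c (p.1.1, p.2.1)))
    (Subtype.ext ((simp1 g).map_smul c (p.1.1, p.2.1)))

theorem derClass_derCoboundary (f g : B →ₐ[k] A)
    (p : Der (AlgHom.id k B) × Der (AlgHom.id k A)) :
    derClass f g (derCoboundary f g p) = 0 := by
  rw [derClass, LinearMap.comp_apply, Submodule.mkQ_apply, Submodule.Quotient.mk_eq_zero]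
  refine ⟨(p.1.1, p.2.1, 0, 0), ?_⟩
  have h1 := (hoch1_eq_zero_iff _ p.1.1).2 p.1.2
  have h2 := (hoch1_eq_zero_iff _ p.2.1).2 p.2.2
  simp only [d1, LinearMap.coe_mk, AddHom.coe_mk, h1, h2, map_zero, sub_zero]
  rfl

end Pair

end DiagramCohomology

/-! ### The four-punctured sphere -/

namespace FourPunctured

open DiagramCohomology

variable {k : Type*} [CommRing k]

/-- `B = k[x, 1/x, 1/(x-1)]`. -/
def B (k : Type*) [CommRing k] := Localization.Away (X * (X - 1) : k[X])

/-- `A = k[x, 1/x, 1/(x-1), 1/(x-l)]`. -/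
def A (l : kˣ) := Localization.Away (X * (X - 1) * (X - C (l : k)) : k[X])

noncomputable instance : CommRing (B k) :=
  inferInstanceAs (CommRing (Localization.Away (X * (X - 1) : k[X])))

noncomputable instance : Algebra k[X] (B k) :=
  inferInstanceAs (Algebra k[X] (Localization.Away (X * (X - 1) : k[X])))

noncomputable instance : Algebra k (B k) :=
  inferInstanceAs (Algebra k (Localization.Away (X * (X - 1) : k[X])))

instance : IsScalarTower k k[X] (B k) :=
  inferInstanceAs (IsScalarTower k k[X] (Localization.Away (X * (X - 1) : k[X])))

instance : IsLocalization.Away (X * (X - 1) : k[X]) (B k) :=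
  inferInstanceAs (IsLocalization.Away (X * (X - 1) : k[X])
    (Localization.Away (X * (X - 1) : k[X])))

noncomputable instance (l : kˣ) : CommRing (A l) :=
  inferInstanceAs (CommRing (Localization.Away (X * (X - 1) * (X - C (l : k)) : k[X])))

noncomputable instance (l : kˣ) : Algebra k[X] (A l) :=
  inferInstanceAs (Algebra k[X] (Localization.Away (X * (X - 1) * (X - C (l : k)) : k[X])))

noncomputable instance (l : kˣ) : Algebra k (A l) :=
  inferInstanceAs (Algebra k (Localization.Away (X * (X - 1) * (X - C (l : k)) : k[X])))

instance (l : kˣ) : IsScalarTower k k[X] (A l) :=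
  inferInstanceAs
    (IsScalarTower k k[X] (Localization.Away (X * (X - 1) * (X - C (l : k)) : k[X])))

instance (l : kˣ) : IsLocalization.Away (X * (X - 1) * (X - C (l : k)) : k[X]) (A l) :=
  inferInstanceAs (IsLocalization.Away (X * (X - 1) * (X - C (l : k)) : k[X])
    (Localization.Away (X * (X - 1) * (X - C (l : k)) : k[X])))

/-- The element `x` of `B`. -/
noncomputable def xB (k : Type*) [CommRing k] : B k := algebraMap k[X] (B k) X

/-- The element `x` of `A`. -/
noncomputable def xA (l : kˣ) : A l := algebraMap k[X] (A l) X

theorem isUnit_den (l : kˣ) :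
    IsUnit (xA l * (xA l - 1) * (xA l - algebraMap k (A l) l)) := by
  have h := IsLocalization.Away.algebraMap_isUnit (S := A l)
    (X * (X - 1) * (X - C (l : k)) : k[X])
  have hC : algebraMap k[X] (A l) (C (l : k)) = algebraMap k (A l) l := by
    rw [IsScalarTower.algebraMap_apply k k[X] (A l), Polynomial.algebraMap_eq]
  rw [map_mul, map_mul, map_sub, map_sub, map_one, hC] at h
  exact h

theorem isUnit_x (l : kˣ) : IsUnit (xA l) :=
  isUnit_of_mul_isUnit_left (isUnit_of_mul_isUnit_left (isUnit_den l))

theorem isUnit_x_sub_one (l : kˣ) : IsUnit (xA l - 1) :=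
  isUnit_of_mul_isUnit_right (isUnit_of_mul_isUnit_left (isUnit_den l))

theorem isUnit_x_sub (l : kˣ) : IsUnit (xA l - algebraMap k (A l) l) :=
  isUnit_of_mul_isUnit_right (isUnit_den l)

/-- The element `1/(x-1)` of `A`. -/
noncomputable def invXSubOne (l : kˣ) : A l := ((isUnit_x_sub_one l).unit⁻¹ : (A l)ˣ)

/-- The algebra map `B → A` that sends `x` to `a`, where `a` and `a - 1` are invertible. -/
noncomputable def substHom (l : kˣ) (a : A l) (h0 : IsUnit a) (h1 : IsUnit (a - 1)) :
    B k →ₐ[k] A l :=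
  IsLocalization.liftAlgHom (M := Submonoid.powers (X * (X - 1) : k[X])) (f := aeval a) (by
    rintro ⟨y, n, rfl⟩
    simp only [map_pow, map_mul, map_sub, aeval_X, map_one]
    exact (h0.mul h1).pow n)

theorem substHom_xB (l : kˣ) (a : A l) (h0 : IsUnit a) (h1 : IsUnit (a - 1)) :
    substHom l a h0 h1 (xB k) = a := by
  simp [substHom, xB]

/-- The map `f : B → A`, `x ↦ x`. -/
noncomputable def f (l : kˣ) : B k →ₐ[k] A l :=
  substHom l (xA l) (isUnit_x l) (isUnit_x_sub_one l)

theorem isUnit_inv_smul_x (l : kˣ) : IsUnit (((l⁻¹ : kˣ) : k) • xA l) := by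
  rw [Algebra.smul_def]
  exact ((l⁻¹ : kˣ).isUnit.map (algebraMap k (A l))).mul (isUnit_x l)

theorem isUnit_inv_smul_x_sub_one (l : kˣ) : IsUnit (((l⁻¹ : kˣ) : k) • xA l - 1) := by
  have h : ((l⁻¹ : kˣ) : k) • xA l - 1
      = algebraMap k (A l) ((l⁻¹ : kˣ) : k) * (xA l - algebraMap k (A l) l) := by
    rw [Algebra.smul_def, mul_sub, ← (algebraMap k (A l)).map_mul, Units.inv_mul,
      (algebraMap k (A l)).map_one]
  rw [h]
  exact ((l⁻¹ : kˣ).isUnit.map (algebraMap k (A l))).mul (isUnit_x_sub l)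

/-- The map `g : B → A`, `x ↦ l⁻¹ x`; thus `g b` is `b(l⁻¹ x)`. -/
noncomputable def g (l : kˣ) : B k →ₐ[k] A l :=
  substHom l (((l⁻¹ : kˣ) : k) • xA l) (isUnit_inv_smul_x l) (isUnit_inv_smul_x_sub_one l)

/-- The submodule of `A` of the elements `b(x) - l b(l⁻¹ x)`, `b ∈ B`. -/
noncomputable def twistedDifferences (l : kˣ) : Submodule k (A l) :=
  LinearMap.range ((f l).toLinearMap - (l : k) • (g l).toLinearMap)

/-- The elements of a `k[x]`-algebra `R` (here a localization of `k[x]`) that are regular at the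
point `c`: those that can be written as a fraction `p / q` with `q(c)` invertible. -/
def regularAt (R : Type*) [CommRing R] [Algebra k R] [Algebra k[X] R] [IsScalarTower k k[X] R]
    (c : k) : Submodule k R where
  carrier := {a | ∃ p q : k[X], IsUnit (q.eval c) ∧ algebraMap k[X] R q * a = algebraMap k[X] R p}
  zero_mem' := ⟨0, 1, by simp⟩
  add_mem' := by
    rintro a a' ⟨p, q, hq, h⟩ ⟨p', q', hq', h'⟩
    refine ⟨q' * p + q * p', q * q', by rw [eval_mul]; exact hq.mul hq', ?_⟩
    rw [map_add, map_mul, map_mul, map_mul, ← h, ← h']; ring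
  smul_mem' := by
    rintro c a ⟨p, q, hq, h⟩
    refine ⟨c • p, q, hq, ?_⟩
    rw [mul_smul_comm, h, Algebra.smul_def, Algebra.smul_def, map_mul,
      ← IsScalarTower.algebraMap_apply]

/-- The pairs `(Γ^f, Γ^g)` of derivations `B → A` (along `f` and `g`) that are regular at `1` and
at `l`: the coefficients `Γ^f(x)`, `Γ^g(x)` are regular there. -/
noncomputable def regularPairs (l : kˣ) : Submodule k (Der (f l) × Der (g l)) where
  carrier := {p | (p.1.1 (xB k) ∈ regularAt (A l) 1 ∧ p.1.1 (xB k) ∈ regularAt (A l) (l : k)) ∧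
    (p.2.1 (xB k) ∈ regularAt (A l) 1 ∧ p.2.1 (xB k) ∈ regularAt (A l) (l : k))}
  zero_mem' := ⟨⟨zero_mem _, zero_mem _⟩, ⟨zero_mem _, zero_mem _⟩⟩
  add_mem' := fun h h' => ⟨⟨add_mem h.1.1 h'.1.1, add_mem h.1.2 h'.1.2⟩,
    ⟨add_mem h.2.1 h'.2.1, add_mem h.2.2 h'.2.2⟩⟩
  smul_mem' := fun c _ h =>
    ⟨⟨Submodule.smul_mem _ c h.1.1, Submodule.smul_mem _ c h.1.2⟩,
      ⟨Submodule.smul_mem _ c h.2.1, Submodule.smul_mem _ c h.2.2⟩⟩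

/-- The pairs `(γ^B, γ^A)` of derivations of `B` and of `A` that are regular at `1` and at `l`. -/
noncomputable def regularDerivations (l : kˣ) :
    Submodule k (Der (AlgHom.id k (B k)) × Der (AlgHom.id k (A l))) where
  carrier := {p | (p.1.1 (xB k) ∈ regularAt (B k) 1 ∧ p.1.1 (xB k) ∈ regularAt (B k) (l : k)) ∧
    (p.2.1 (xA l) ∈ regularAt (A l) 1 ∧ p.2.1 (xA l) ∈ regularAt (A l) (l : k))}
  zero_mem' := ⟨⟨zero_mem _, zero_mem _⟩, ⟨zero_mem _, zero_mem _⟩⟩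
  add_mem' := fun h h' => ⟨⟨add_mem h.1.1 h'.1.1, add_mem h.1.2 h'.1.2⟩,
    ⟨add_mem h.2.1 h'.2.1, add_mem h.2.2 h'.2.2⟩⟩
  smul_mem' := fun c _ h =>
    ⟨⟨Submodule.smul_mem _ c h.1.1, Submodule.smul_mem _ c h.1.2⟩,
      ⟨Submodule.smul_mem _ c h.2.1, Submodule.smul_mem _ c h.2.2⟩⟩

/-- The second cohomology with regular derivations only: regular pairs `(Γ^f, Γ^g)` modulo the
coboundaries of regular pairs `(γ^B, γ^A)`. -/
abbrev RegularH2 (l : kˣ) :=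
  regularPairs l ⧸
    ((regularDerivations l).map (derCoboundary (f l) (g l))).comap (regularPairs l).subtype

/-- The natural map from the regular cohomology to the cohomology of the diagram. -/
noncomputable def regularToH2 (l : kˣ) : RegularH2 l →ₗ[k] H2 (f l) (g l) :=
  Submodule.liftQ _ (derClass (f l) (g l) ∘ₗ (regularPairs l).subtype) (by
    rintro p ⟨q, -, hq⟩
    rw [LinearMap.mem_ker, LinearMap.comp_apply, ← hq, derClass_derCoboundary])

end FourPunctured

/-!
`B` and `A` are localizations of `k[x]`, so an algebra map or a derivation out of them is determined
by its value at `x`, and derivations may be prescribed there. Their second Hochschild cohomology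
vanishes (`exists_hoch1_eq`): the antisymmetrization of a 2-cocycle is a biderivation that is zero at
`(x, x)`, so the cocycle is symmetric and defines a commutative square-zero extension, which splits by
formal smoothness. Hence every class of the diagram comes from a pair of derivations, and the
coboundaries among these pairs are those of derivations of `B` and `A`. Taking values at `x`, the
coboundary of `(b, a)` is `(f b - a, g b - l⁻¹ a)`; eliminating `a` identifies `H²` with the quotient
of `A` by the twisted differences `f b - l g b` (`h2Equiv`).

The quotient is studied with partial fractions. `B` is spanned by the `x ^ n` and `1 / (x - 1) ^ N`,
whose twisted differences are `(1 - l ^ (1 - n)) x ^ n` and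
`1 / (x - 1) ^ N - l ^ (N + 1) / (x - l) ^ N`. If `1 - l` is invertible, `A` is spanned by the
`x ^ n`, `1 / (x - 1) ^ N` and `1 / (x - l) ^ N`, and coefficients of Laurent expansions at `1`, `l` and
infinity give functionals on the quotient that are dual to `x` and the `1 / (x - 1) ^ N`
(`exists_dual`). This makes the quotient infinitely generated, and when all `1 - l ^ n` are
invertible these classes also span, so they form a basis (`quotientBasis`). If `1 - l` is not
invertible, then `l = 1` modulo some maximal ideal, and coefficients at infinity modulo this ideal show
that the quotient is not finitely generated (`not_finite_quotient`).

The elements of `A` that are regular at `1` and `l` are the Laurent polynomials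
(`mem_laurentA_iff`), and each of these is a multiple of `x` plus the twisted difference of a Laurent
polynomial (`exists_eq_smul_xA_add`). Both statements on regular derivations follow.
-/

namespace DiagramCohomology

/-! ### Derivations of a localization of the polynomial ring -/

section Derivations

variable {k C R : Type*} [CommRing k] [CommRing C] [Algebra k C] [CommRing R] [Algebra k R]

/-- The algebra map `c ↦ φ c + ε D c` into the dual numbers given by a derivation `D` along `φ`. -/
noncomputable def Der.toAlgHom {φ : C →ₐ[k] R} {D : C →ₗ[k] R} (hD : D ∈ Der φ) :
    C →ₐ[k] TrivSqZeroExt R R :=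
  AlgHom.ofLinearMap
    ((TrivSqZeroExt.inlAlgHom k R R).toLinearMap ∘ₗ φ.toLinearMap +
      (TrivSqZeroExt.inrHom R R).restrictScalars k ∘ₗ D)
    (by
      have h := hD 1 1
      simp only [mul_one, map_one, one_mul, left_eq_add] at h
      ext <;> simp [h])
    (by
      intro c c'
      ext
      · simp
      · simp [hD c c', mul_comm])

theorem Der.toAlgHom_apply {φ : C →ₐ[k] R} {D : C →ₗ[k] R} (hD : D ∈ Der φ) (c : C) :
    Der.toAlgHom hD c = TrivSqZeroExt.inl (φ c) + TrivSqZeroExt.inr (D c) := rfl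

variable [Algebra k[X] C] [IsScalarTower k k[X] C]

/-- Two algebra maps out of a localization of `k[x]` are equal as soon as they agree at `x`. -/
theorem algHom_ext_of_X (M : Submonoid k[X]) [IsLocalization M C] {S : Type*} [Semiring S]
    [Algebra k S] {u v : C →ₐ[k] S}
    (h : u (algebraMap k[X] C X) = v (algebraMap k[X] C X)) : u = v :=
  IsLocalization.algHom_ext M (Polynomial.algHom_ext h)

theorem Der.ext_of_X (M : Submonoid k[X]) [IsLocalization M C] {φ : C →ₐ[k] R}
    {D D' : C →ₗ[k] R} (hD : D ∈ Der φ) (hD' : D' ∈ Der φ)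
    (h : D (algebraMap k[X] C X) = D' (algebraMap k[X] C X)) : D = D' := by
  have e : Der.toAlgHom hD = Der.toAlgHom hD' :=
    algHom_ext_of_X M (by rw [Der.toAlgHom_apply, Der.toAlgHom_apply, h])
  ext c
  simpa [Der.toAlgHom_apply] using congrArg TrivSqZeroExt.snd (DFunLike.congr_fun e c)

/-- A derivation along `φ` can be prescribed at `x`: lift `x ↦ φ(x) + ε a` to the dual numbers. -/
theorem Der.exists_apply_X (M : Submonoid k[X]) [IsLocalization M C] (φ : C →ₐ[k] R) (a : R) :
    ∃ D ∈ Der φ, D (algebraMap k[X] C X) = a := by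
  let t : TrivSqZeroExt R R :=
    TrivSqZeroExt.inl (φ (algebraMap k[X] C X)) + TrivSqZeroExt.inr a
  have hfst : (TrivSqZeroExt.fstHom k R R).comp (aeval t)
      = φ.comp (IsScalarTower.toAlgHom k k[X] C) := by
    apply Polynomial.algHom_ext
    simp [t]
  have hu : ∀ y : M, IsUnit (aeval (R := k) t (y : k[X])) := by
    intro y
    rw [TrivSqZeroExt.isUnit_iff_isUnit_fst]
    have h := DFunLike.congr_fun hfst (y : k[X])
    simp only [AlgHom.comp_apply, TrivSqZeroExt.fstHom_apply, IsScalarTower.coe_toAlgHom'] at h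
    rw [h]
    exact (IsLocalization.map_units C y).map φ
  let ψ : C →ₐ[k] TrivSqZeroExt R R := IsLocalization.liftAlgHom (M := M) (f := aeval t) hu
  have hψX : ψ (algebraMap k[X] C X) = t := by simp [ψ]
  have hψ : (TrivSqZeroExt.fstHom k R R).comp ψ = φ :=
    algHom_ext_of_X M (by rw [AlgHom.comp_apply, hψX]; simp [t])
  have hψ' (c : C) : (ψ c).fst = φ c := DFunLike.congr_fun hψ c
  refine ⟨(TrivSqZeroExt.sndHom R R).restrictScalars k ∘ₗ ψ.toLinearMap, ?_, ?_⟩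
  · intro b b'
    simp [hψ', mul_comm]
  · simp [hψX, t]

/-- A derivation along `φ : C → R`, for `C` a localization of `k[x]`, is the same thing as its
value at `x`. -/
noncomputable def Der.evalX (M : Submonoid k[X]) [IsLocalization M C] (φ : C →ₐ[k] R) :
    Der φ ≃ₗ[k] R :=
  LinearEquiv.ofBijective (LinearMap.applyₗ (algebraMap k[X] C X) ∘ₗ (Der φ).subtype)
    ⟨fun D D' h => Subtype.ext (Der.ext_of_X M D.2 D'.2 h), fun a =>
      let ⟨D, hD, h⟩ := Der.exists_apply_X M φ a
      ⟨⟨D, hD⟩, h⟩⟩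

end Derivations

/-! ### Vanishing of the second Hochschild cohomology -/

section SquareZero

variable {k C : Type*} [CommRing k] [CommRing C] [Algebra k C]

theorem hoch2_id_eq {F : Cochain2 k C C} (hF : hoch2 (AlgHom.id k C) F = 0) (a b c : C) :
    a * F b c - F (a * b) c + F a (b * c) - F a b * c = 0 := by
  have h := congrArg (fun G : Cochain3 k C C => G a b c) hF
  simpa using h

/-- The square-zero extension of `C` by `C` defined by a symmetric 2-cocycle `F`: the module
`C × C` with the product `(a, m) (b, n) = (a b, a n + m b + F(a, b))`. As `F` is not assumed to be
normalized, the unit is `(1, -F(1, 1))`. -/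
def CocycleExt (F : Cochain2 k C C) (_ : hoch2 (AlgHom.id k C) F = 0)
    (_ : ∀ a b, F a b = F b a) : Type _ := C × C

namespace CocycleExt

variable {F : Cochain2 k C C} {hF : hoch2 (AlgHom.id k C) F = 0} {hs : ∀ a b, F a b = F b a}

instance : AddCommGroup (CocycleExt F hF hs) := inferInstanceAs (AddCommGroup (C × C))

instance : Module k (CocycleExt F hF hs) := inferInstanceAs (Module k (C × C))

instance : Mul (CocycleExt F hF hs) :=
  ⟨fun p q => (p.1 * q.1, p.1 * q.2 + p.2 * q.1 + F p.1 q.1)⟩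

instance : One (CocycleExt F hF hs) := ⟨((1 : C), -F 1 1)⟩

@[ext] theorem ext {p q : CocycleExt F hF hs} (h₁ : p.1 = q.1) (h₂ : p.2 = q.2) : p = q :=
  Prod.ext h₁ h₂

@[simp] theorem fst_mul (p q : CocycleExt F hF hs) : (p * q).1 = p.1 * q.1 := rfl
@[simp] theorem snd_mul (p q : CocycleExt F hF hs) :
    (p * q).2 = p.1 * q.2 + p.2 * q.1 + F p.1 q.1 := rfl
@[simp] theorem fst_one : (1 : CocycleExt F hF hs).1 = 1 := rfl
@[simp] theorem snd_one : (1 : CocycleExt F hF hs).2 = -F 1 1 := rfl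
@[simp] theorem fst_add (p q : CocycleExt F hF hs) : (p + q).1 = p.1 + q.1 := rfl
@[simp] theorem snd_add (p q : CocycleExt F hF hs) : (p + q).2 = p.2 + q.2 := rfl
@[simp] theorem fst_zero : (0 : CocycleExt F hF hs).1 = 0 := rfl
@[simp] theorem snd_zero : (0 : CocycleExt F hF hs).2 = 0 := rfl
@[simp] theorem fst_smul (r : k) (p : CocycleExt F hF hs) : (r • p).1 = r • p.1 := rfl
@[simp] theorem snd_smul (r : k) (p : CocycleExt F hF hs) : (r • p).2 = r • p.2 := rfl

theorem mul_comm' (p q : CocycleExt F hF hs) : p * q = q * p := by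
  ext
  · simp [mul_comm]
  · simp only [snd_mul, hs p.1 q.1]; ring

theorem one_mul' (p : CocycleExt F hF hs) : 1 * p = p := by
  ext
  · simp
  · have h := hoch2_id_eq hF 1 1 p.1
    simp only [one_mul] at h
    simp only [snd_mul, fst_one, snd_one]
    linear_combination h

theorem left_distrib' (p q r : CocycleExt F hF hs) : p * (q + r) = p * q + p * r := by
  ext
  · simp [mul_add]
  · simp only [snd_mul, snd_add, fst_add, map_add]; ring

instance : CommRing (CocycleExt F hF hs) :=
  { (inferInstance : AddCommGroup (CocycleExt F hF hs)) with
    mul := (· * ·)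
    one := 1
    mul_comm := mul_comm'
    one_mul := one_mul'
    mul_one := fun p => by rw [mul_comm', one_mul']
    left_distrib := left_distrib'
    right_distrib := fun p q r => by
      rw [mul_comm', left_distrib', mul_comm' r p, mul_comm' r q]
    zero_mul := fun p => by ext <;> simp
    mul_zero := fun p => by ext <;> simp
    mul_assoc := fun p q r => by
      ext
      · simp [mul_assoc]
      · have h := hoch2_id_eq hF p.1 q.1 r.1
        simp only [snd_mul, fst_mul]
        linear_combination -h }

theorem smul_mul' (r : k) (p q : CocycleExt F hF hs) : r • p * q = r • (p * q) := by
  ext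
  · simp
  · simp [smul_add]

instance : Algebra k (CocycleExt F hF hs) :=
  Algebra.ofModule smul_mul' fun r p q => by
    rw [mul_comm', smul_mul', mul_comm' q p]

variable (F hF hs) in
/-- The projection of the square-zero extension to `C`. -/
def proj : CocycleExt F hF hs →ₐ[k] C :=
  AlgHom.ofLinearMap
    { toFun := fun p => p.1
      map_add' := fun _ _ => rfl
      map_smul' := fun _ _ => rfl } rfl fun _ _ => rfl

theorem proj_surjective : Function.Surjective (proj F hF hs) := fun c => ⟨(c, (0 : C)), rfl⟩

theorem isNilpotent_ker_proj : IsNilpotent (RingHom.ker (proj F hF hs : CocycleExt F hF hs →+* C)) := by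
  refine ⟨2, ?_⟩
  rw [pow_two, Ideal.zero_eq_bot, eq_bot_iff, Ideal.mul_le]
  intro p hp q hq
  have hp' : p.1 = 0 := hp
  have hq' : q.1 = 0 := hq
  rw [Ideal.mem_bot]
  ext <;> simp [hp', hq']

end CocycleExt

/-- A symmetric 2-cocycle of a formally smooth algebra is a coboundary: an algebra section of its
square-zero extension has a primitive of the cocycle as second component. -/
theorem exists_hoch1_eq_of_symm [Algebra.FormallySmooth k C] {F : Cochain2 k C C}
    (hF : hoch2 (AlgHom.id k C) F = 0) (hs : ∀ a b, F a b = F b a) :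
    ∃ D : Cochain1 k C C, hoch1 (AlgHom.id k C) D = F := by
  let σ : C →ₐ[k] CocycleExt F hF hs := Algebra.FormallySmooth.liftOfSurjective (AlgHom.id k C)
    (CocycleExt.proj F hF hs) CocycleExt.proj_surjective CocycleExt.isNilpotent_ker_proj
  have hσ (c : C) : (σ c).1 = c :=
    Algebra.FormallySmooth.liftOfSurjective_apply (AlgHom.id k C)
      (CocycleExt.proj F hF hs) CocycleExt.proj_surjective CocycleExt.isNilpotent_ker_proj c
  refine ⟨-{ toFun := fun c => (σ c).2
             map_add' := fun a b => by rw [map_add]; rfl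
             map_smul' := fun r a => by rw [map_smul]; rfl }, ?_⟩
  ext a b
  have h := congrArg Prod.snd (map_mul σ a b)
  change (σ (a * b)).2 = (σ a * σ b).2 at h
  rw [CocycleExt.snd_mul, hσ, hσ] at h
  simp only [hoch1_apply, AlgHom.coe_id, id_eq, LinearMap.neg_apply, LinearMap.coe_mk,
    AddHom.coe_mk, h]
  ring

variable [Algebra k[X] C] [IsScalarTower k k[X] C]

/-- A 2-cocycle of a localization of `k[x]` is symmetric: its antisymmetrization is a derivation in
each variable and vanishes at `(x, x)`. -/
theorem cocycle_symm (M : Submonoid k[X]) [IsLocalization M C] {F : Cochain2 k C C}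
    (hF : hoch2 (AlgHom.id k C) F = 0) (a b : C) : F a b = F b a := by
  let G : C →ₗ[k] C →ₗ[k] C := F - F.flip
  have hG (a b : C) : G a b = F a b - F b a := rfl
  have hder (c : C) : G.flip c ∈ Der (AlgHom.id k C) := by
    intro a b
    have h₁ := hoch2_id_eq hF a b c
    have h₂ := hoch2_id_eq hF a c b
    have h₃ := hoch2_id_eq hF c a b
    rw [mul_comm c b] at h₂
    rw [mul_comm c a] at h₃
    simp only [LinearMap.flip_apply, hG, AlgHom.coe_id, id_eq]
    linear_combination -h₁ + h₂ - h₃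
  have hX (c : C) : G c (algebraMap k[X] C X) = 0 := by
    have h := Der.ext_of_X M (hder (algebraMap k[X] C X)) (zero_mem _) (by simp [hG])
    simpa using DFunLike.congr_fun h c
  have hab : G a b = 0 := by
    have h := Der.ext_of_X M (hder b) (zero_mem _) (by
      rw [LinearMap.flip_apply, LinearMap.zero_apply, hG, ← neg_sub, ← hG, hX, neg_zero])
    simpa using DFunLike.congr_fun h a
  exact sub_eq_zero.1 hab

/-- The second Hochschild cohomology of a localization of `k[x]` in itself vanishes. -/
theorem exists_hoch1_eq (M : Submonoid k[X]) [IsLocalization M C] {F : Cochain2 k C C}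
    (hF : hoch2 (AlgHom.id k C) F = 0) : ∃ D : Cochain1 k C C, hoch1 (AlgHom.id k C) D = F := by
  have : Algebra.FormallySmooth k[X] C := Algebra.FormallySmooth.of_isLocalization M
  have : Algebra.FormallySmooth k C := Algebra.FormallySmooth.comp k k[X] C
  exact exists_hoch1_eq_of_symm hF (cocycle_symm M hF)

end SquareZero

/-! ### Classes of pairs of derivations -/

section Pair

variable {k B A : Type*} [CommRing k] [CommRing B] [Algebra k B] [CommRing A] [Algebra k A]

/-- If the second Hochschild cohomologies of `B` and `A` vanish, every 2-cocycle of the diagram is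
cohomologous to one whose components on `B` and `A` are zero; the other two components are then
derivations. -/
theorem derClass_surjective (f g : B →ₐ[k] A)
    (hB : ∀ F : Cochain2 k B B, hoch2 (AlgHom.id k B) F = 0 → ∃ D, hoch1 (AlgHom.id k B) D = F)
    (hA : ∀ F : Cochain2 k A A, hoch2 (AlgHom.id k A) F = 0 → ∃ D, hoch1 (AlgHom.id k A) D = F) :
    Function.Surjective (derClass f g) := by
  intro c
  obtain ⟨⟨Γ, hΓ⟩, rfl⟩ := Submodule.mkQ_surjective _ c
  have hd : d2 f g Γ = 0 := hΓ
  obtain ⟨DB, hDB⟩ := hB Γ.1 (congrArg (fun t => t.1) hd)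
  obtain ⟨DA, hDA⟩ := hA Γ.2.1 (congrArg (fun t => t.2.1) hd)
  let γ : C1 k B A := (DB, DA, 0, 0)
  have hd1 : d2 f g (d1 f g γ) = 0 := DFunLike.congr_fun (d2_comp_d1 f g) γ
  have hfst : (Γ - d1 f g γ).1 = 0 := sub_eq_zero.2 hDB.symm
  have hsnd : (Γ - d1 f g γ).2.1 = 0 := sub_eq_zero.2 hDA.symm
  have hd' : d2 f g (Γ - d1 f g γ) = 0 := by rw [map_sub, hd, hd1, sub_zero]
  generalize hΔ : Γ - d1 f g γ = Δ at hfst hsnd hd'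
  obtain ⟨ΔB, ΔA, Δf, Δg⟩ := Δ
  simp only at hfst hsnd
  subst hfst hsnd
  have h0 (φ : B →ₐ[k] A) : simp2 φ (0, 0) = 0 := (simp2 φ).map_zero
  have hf : simp2 f (0, 0) - hoch1 f Δf = 0 := congrArg (fun t => t.2.2.1) hd'
  have hg : simp2 g (0, 0) - hoch1 g Δg = 0 := congrArg (fun t => t.2.2.2) hd'
  rw [h0, zero_sub, neg_eq_zero, hoch1_eq_zero_iff] at hf hg
  refine ⟨(⟨Δf, hf⟩, ⟨Δg, hg⟩), ?_⟩
  rw [derClass, LinearMap.comp_apply, Submodule.mkQ_apply, Submodule.mkQ_apply, eq_comm,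
    Submodule.Quotient.eq]
  refine ⟨γ, ?_⟩
  change d1 f g γ = Γ - (0, 0, Δf, Δg)
  rw [← hΔ, sub_sub_cancel]

/-- For commutative algebras the coboundaries of the form `(0, 0, Γ^f, Γ^g)` are the coboundaries
of pairs of derivations. -/
theorem ker_derClass (f g : B →ₐ[k] A) :
    LinearMap.ker (derClass f g) = LinearMap.range (derCoboundary f g) := by
  apply le_antisymm
  · rintro ⟨Γf, Γg⟩ h
    rw [LinearMap.mem_ker, derClass, LinearMap.comp_apply, Submodule.mkQ_apply,
      Submodule.Quotient.mk_eq_zero] at h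
    obtain ⟨⟨γB, γA, m, n⟩, hγ⟩ := h
    have h0 (φ : B →ₐ[k] A) (m : A) : hoch0 φ m = 0 := by
      ext b; simp [mul_comm]
    have hB : hoch1 (AlgHom.id k B) γB = 0 := congrArg (fun t => t.1) hγ
    have hA : hoch1 (AlgHom.id k A) γA = 0 := congrArg (fun t => t.2.1) hγ
    have hf : simp1 f (γB, γA) - hoch0 f m = Γf.1 := congrArg (fun t => t.2.2.1) hγ
    have hg : simp1 g (γB, γA) - hoch0 g n = Γg.1 := congrArg (fun t => t.2.2.2) hγ
    rw [h0, sub_zero] at hf hg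
    exact ⟨(⟨γB, (hoch1_eq_zero_iff _ _).1 hB⟩, ⟨γA, (hoch1_eq_zero_iff _ _).1 hA⟩),
      Prod.ext (Subtype.ext hf) (Subtype.ext hg)⟩
  · rintro _ ⟨p, rfl⟩
    exact derClass_derCoboundary f g p

end Pair

end DiagramCohomology

namespace FourPunctured

open DiagramCohomology

/-! ### The second cohomology as a quotient of `A` -/

section Cohomology

variable {k : Type*} [CommRing k] (l : kˣ)

theorem f_xB : f l (xB k) = xA l := substHom_xB _ _ _ _

theorem g_xB : g l (xB k) = ((l⁻¹ : kˣ) : k) • xA l := substHom_xB _ _ _ _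

theorem derClass_surjective : Function.Surjective (derClass (f l) (g l)) :=
  DiagramCohomology.derClass_surjective _ _
    (fun _ h => exists_hoch1_eq (.powers (X * (X - 1) : k[X])) h)
    (fun _ h => exists_hoch1_eq (.powers (X * (X - 1) * (X - C (l : k)) : k[X])) h)

/-- Derivations of `B` are identified with their values at `x`. -/
noncomputable def derB : Der (AlgHom.id k (B k)) ≃ₗ[k] B k :=
  Der.evalX (.powers (X * (X - 1) : k[X])) _

/-- Derivations of `A` are identified with their values at `x`. -/
noncomputable def derA : Der (AlgHom.id k (A l)) ≃ₗ[k] A l :=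
  Der.evalX (.powers (X * (X - 1) * (X - C (l : k)) : k[X])) _

/-- Derivations `B → A` along `φ` are identified with their values at `x`. -/
noncomputable def derBA {l : kˣ} (φ : B k →ₐ[k] A l) : Der φ ≃ₗ[k] A l :=
  Der.evalX (.powers (X * (X - 1) : k[X])) φ

theorem derBA_apply {l : kˣ} (φ : B k →ₐ[k] A l) (D : Der φ) : derBA φ D = D.1 (xB k) := rfl

/-- In terms of values at `x`, the coboundary of `(b, a)` is `(f b - a, g b - l⁻¹ a)`. -/
theorem derCoboundary_fst_xB (p : Der (AlgHom.id k (B k)) × Der (AlgHom.id k (A l))) :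
    (derCoboundary (f l) (g l) p).1.1 (xB k) = f l (p.1.1 (xB k)) - p.2.1 (xA l) := by
  change f l (p.1.1 (xB k)) - p.2.1 (f l (xB k)) = _
  rw [f_xB]

theorem derCoboundary_snd_xB (p : Der (AlgHom.id k (B k)) × Der (AlgHom.id k (A l))) :
    (derCoboundary (f l) (g l) p).2.1 (xB k) =
      g l (p.1.1 (xB k)) - ((l⁻¹ : kˣ) : k) • p.2.1 (xA l) := by
  change g l (p.1.1 (xB k)) - p.2.1 (g l (xB k)) = _
  rw [g_xB, map_smul]

/-- The map `(Γ^f, Γ^g) ↦ Γ^f(x) - l Γ^g(x)`. -/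
noncomputable def evalDiff : (Der (f l) × Der (g l)) →ₗ[k] A l :=
  (derBA (f l)).toLinearMap ∘ₗ LinearMap.fst k _ _ -
    (l : k) • ((derBA (g l)).toLinearMap ∘ₗ LinearMap.snd k _ _)

theorem evalDiff_apply (p : Der (f l) × Der (g l)) :
    evalDiff l p = p.1.1 (xB k) - (l : k) • p.2.1 (xB k) := rfl

theorem evalDiff_surjective : Function.Surjective (evalDiff l) := fun a =>
  ⟨((derBA (f l)).symm a, 0), by
    rw [evalDiff_apply, ← derBA_apply, LinearEquiv.apply_symm_apply]; simp⟩

/-- A pair with `Γ^f(x) - l Γ^g(x) = f b - l g b` is the coboundary of the derivations with values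
`b` and `f b - Γ^f(x)` at `x`. -/
theorem derCoboundary_of_evalDiff_eq {p : Der (f l) × Der (g l)} {b : B k}
    (h : f l b - (l : k) • g l b = evalDiff l p) :
    derCoboundary (f l) (g l) (derB.symm b, (derA l).symm (f l b - p.1.1 (xB k))) = p := by
  have e₁ : (derB.symm b).1 (xB k) = b := derB.apply_symm_apply b
  have e₂ (a : A l) : ((derA l).symm a).1 (xA l) = a := (derA l).apply_symm_apply a
  refine Prod.ext ((derBA _).injective ?_) ((derBA _).injective ?_)
  · rw [derBA_apply, derBA_apply, derCoboundary_fst_xB, e₁, e₂, sub_sub_cancel]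
  · rw [derBA_apply, derBA_apply, derCoboundary_snd_xB, e₁, e₂]
    have h' : f l b - p.1.1 (xB k) = (l : k) • (g l b - p.2.1 (xB k)) := by
      rw [evalDiff_apply] at h
      rw [smul_sub, sub_eq_sub_iff_sub_eq_sub, h]
    rw [h', smul_smul, Units.inv_mul, one_smul, sub_sub_cancel]

theorem evalDiff_derCoboundary (p : Der (AlgHom.id k (B k)) × Der (AlgHom.id k (A l))) :
    evalDiff l (derCoboundary (f l) (g l) p) ∈ twistedDifferences l := by
  refine ⟨p.1.1 (xB k), ?_⟩
  rw [evalDiff_apply, derCoboundary_fst_xB, derCoboundary_snd_xB, smul_sub, smul_smul,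
    Units.mul_inv, one_smul, sub_sub_sub_cancel_right]
  rfl

theorem ker_derClass_eq :
    LinearMap.ker (derClass (f l) (g l)) = (twistedDifferences l).comap (evalDiff l) := by
  rw [ker_derClass]
  apply le_antisymm
  · rintro _ ⟨p, rfl⟩
    exact evalDiff_derCoboundary l p
  · rintro p ⟨b, hb⟩
    exact ⟨_, derCoboundary_of_evalDiff_eq l hb⟩

/-- The isomorphism of `H²` with `A / {b(x) - l b(l⁻¹ x)}` induced by
`(Γ^f, Γ^g) ↦ Γ^f(x) - l Γ^g(x)`. -/
noncomputable def h2Equiv : H2 (f l) (g l) ≃ₗ[k] A l ⧸ twistedDifferences l :=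
  (LinearMap.quotKerEquivOfSurjective _ (derClass_surjective l)).symm ≪≫ₗ
    Submodule.quotEquivOfEq _ _ (by
      rw [ker_derClass_eq, LinearMap.ker_comp, Submodule.ker_mkQ]) ≪≫ₗ
    LinearMap.quotKerEquivOfSurjective ((twistedDifferences l).mkQ ∘ₗ evalDiff l)
      ((Submodule.mkQ_surjective _).comp (evalDiff_surjective l))

theorem h2Equiv_derClass (p : Der (f l) × Der (g l)) :
    h2Equiv l (derClass (f l) (g l) p) = Submodule.Quotient.mk (evalDiff l p) := by
  have h : (LinearMap.quotKerEquivOfSurjective _ (derClass_surjective l)).symm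
      (derClass (f l) (g l) p) = Submodule.Quotient.mk p := by
    rw [LinearEquiv.symm_apply_eq]; rfl
  rw [h2Equiv, LinearEquiv.trans_apply, LinearEquiv.trans_apply, h]
  rfl

end Cohomology

/-! ### Partial fractions -/

section PartialFractions

variable {k R ι : Type*} [CommRing k] [CommRing R] [Algebra k R]

/-- The span of the Laurent monomials `x ^ n` and of the powers `y i ^ N`, `N > 0`, where `y i`
stands for `1 / (x - c i)`. -/
def partialFractions (k : Type*) {R ι : Type*} [CommRing k] [CommRing R] [Algebra k R] (x : Rˣ)
    (y : ι → R) : Submodule k R :=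
  Submodule.span k (Set.range (fun n : ℤ => ((x ^ n : Rˣ) : R))) ⊔
    ⨆ i, Submodule.span k (Set.range (fun N : ℕ+ => y i ^ (N : ℕ)))

variable {x : Rˣ} {y : ι → R} {c : ι → k}

theorem zpow_mem_partialFractions (n : ℤ) : ((x ^ n : Rˣ) : R) ∈ partialFractions k x y :=
  (le_sup_left : _ ≤ partialFractions k x y) (Submodule.subset_span ⟨n, rfl⟩)

theorem one_mem_partialFractions : (1 : R) ∈ partialFractions k x y := by
  simpa using zpow_mem_partialFractions (k := k) (x := x) (y := y) 0

theorem pow_mem_partialFractions (i : ι) (N : ℕ) : y i ^ N ∈ partialFractions k x y := by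
  rcases Nat.eq_zero_or_pos N with rfl | hN
  · simpa using one_mem_partialFractions
  · exact (le_sup_right : _ ≤ partialFractions k x y)
      (Submodule.mem_iSup_of_mem i (Submodule.subset_span ⟨⟨N, hN⟩, rfl⟩))

/-- To be stable under multiplication by `r` can be checked on the partial fractions. -/
theorem mul_mem_partialFractions {r : R}
    (h₁ : ∀ n : ℤ, r * ((x ^ n : Rˣ) : R) ∈ partialFractions k x y)
    (h₂ : ∀ i, ∀ N : ℕ, r * y i ^ N ∈ partialFractions k x y) {v : R}
    (hv : v ∈ partialFractions k x y) : r * v ∈ partialFractions k x y := by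
  have h : partialFractions k x y ≤ (partialFractions k x y).comap (LinearMap.mulLeft k r) := by
    refine sup_le (Submodule.span_le.2 ?_) (iSup_le fun i => Submodule.span_le.2 ?_)
    · rintro _ ⟨n, rfl⟩
      exact h₁ n
    · rintro _ ⟨N, rfl⟩
      exact h₂ i N
  exact h hv

theorem mul_zpow_mem_partialFractions (hc : ∀ i, IsUnit (c i))
    (hy : ∀ i, y i * (x - algebraMap k R (c i)) = 1) (i : ι) (n : ℤ) :
    y i * ((x ^ n : Rˣ) : R) ∈ partialFractions k x y := by
  have hstep (n : ℤ) : y i * ((x ^ (n + 1) : Rˣ) : R)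
      = ((x ^ n : Rˣ) : R) + c i • (y i * ((x ^ n : Rˣ) : R)) := by
    rw [zpow_add_one, Units.val_mul, Algebra.smul_def]
    linear_combination ((x ^ n : Rˣ) : R) * hy i
  induction n using Int.induction_on with
  | zero => simpa using pow_mem_partialFractions (k := k) (x := x) (y := y) i 1
  | succ n ih =>
    rw [hstep]
    exact add_mem (zpow_mem_partialFractions _) (Submodule.smul_mem _ _ ih)
  | pred n ih =>
    have h := hstep (-n - 1)
    rw [sub_add_cancel] at h
    rw [h] at ih
    obtain ⟨u, hu⟩ := hc i
    rw [← hu, Submodule.add_mem_iff_right _ (zpow_mem_partialFractions _)] at ih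
    exact (Submodule.smul_mem_iff_of_isUnit _ u.isUnit).1 ih

theorem mul_pow_mem_partialFractions (hcc : ∀ i j, i ≠ j → IsUnit (c i - c j))
    (hy : ∀ i, y i * (x - algebraMap k R (c i)) = 1) (i j : ι) (N : ℕ) :
    y i * y j ^ N ∈ partialFractions k x y := by
  rcases eq_or_ne i j with rfl | hij
  · rw [← pow_succ']
    exact pow_mem_partialFractions i _
  · induction N with
    | zero => simpa using pow_mem_partialFractions (k := k) (x := x) (y := y) i 1
    | succ N ih =>
      refine (Submodule.smul_mem_iff_of_isUnit _ (hcc i j hij)).1 ?_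
      have h : (c i - c j) • (y i * y j ^ (N + 1)) = y i * y j ^ N - y j ^ (N + 1) := by
        rw [Algebra.smul_def, map_sub]
        linear_combination y i * y j ^ N * hy j - y j ^ (N + 1) * hy i
      rw [h]
      exact sub_mem ih (pow_mem_partialFractions j _)

theorem inv_mul_pow_mem_partialFractions (hc : ∀ i, IsUnit (c i))
    (hy : ∀ i, y i * (x - algebraMap k R (c i)) = 1) (i : ι) (N : ℕ) :
    ((x⁻¹ : Rˣ) : R) * y i ^ N ∈ partialFractions k x y := by
  induction N with
  | zero => simpa using zpow_mem_partialFractions (k := k) (x := x) (y := y) (-1)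
  | succ N ih =>
    refine (Submodule.smul_mem_iff_of_isUnit _ (hc i)).1 ?_
    have h : c i • (((x⁻¹ : Rˣ) : R) * y i ^ (N + 1))
        = y i ^ (N + 1) - ((x⁻¹ : Rˣ) : R) * y i ^ N := by
      rw [Algebra.smul_def]
      linear_combination y i ^ (N + 1) * x.inv_mul - ((x⁻¹ : Rˣ) : R) * y i ^ N * hy i
    rw [h]
    exact sub_mem (pow_mem_partialFractions i _) ih

theorem self_mul_pow_mem_partialFractions
    (hy : ∀ i, y i * (x - algebraMap k R (c i)) = 1) (i : ι) (N : ℕ) :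
    (x : R) * y i ^ N ∈ partialFractions k x y := by
  cases N with
  | zero => simpa using zpow_mem_partialFractions (k := k) (x := x) (y := y) 1
  | succ N =>
    have h : (x : R) * y i ^ (N + 1) = y i ^ N + c i • y i ^ (N + 1) := by
      rw [Algebra.smul_def]
      linear_combination y i ^ N * hy i
    rw [h]
    exact add_mem (pow_mem_partialFractions i _)
      (Submodule.smul_mem _ _ (pow_mem_partialFractions i _))

/-- Partial fraction decomposition: if the points `c i` and their differences are invertible, the
algebra generated by `x`, `1 / x` and the `1 / (x - c i)` is spanned by partial fractions, because
their span is stable under multiplication by the generators. -/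
theorem partialFractions_eq_top (hc : ∀ i, IsUnit (c i))
    (hcc : ∀ i j, i ≠ j → IsUnit (c i - c j))
    (hy : ∀ i, y i * (x - algebraMap k R (c i)) = 1)
    (htop : Algebra.adjoin k ({(x : R), ((x⁻¹ : Rˣ) : R)} ∪ Set.range y) = ⊤) :
    partialFractions k x y = ⊤ := by
  have key : ∀ r ∈ Algebra.adjoin k ({(x : R), ((x⁻¹ : Rˣ) : R)} ∪ Set.range y),
      ∀ v ∈ partialFractions k x y, r * v ∈ partialFractions k x y := by
    intro r hr
    induction hr using Algebra.adjoin_induction with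
    | mem r hr =>
      intro v hv
      rcases hr with (rfl | rfl) | ⟨i, rfl⟩
      · refine mul_mem_partialFractions (fun n => ?_)
          (self_mul_pow_mem_partialFractions hy) hv
        have h := zpow_mem_partialFractions (k := k) (x := x) (y := y) (1 + n)
        rwa [zpow_add, zpow_one, Units.val_mul] at h
      · refine mul_mem_partialFractions (fun n => ?_)
          (inv_mul_pow_mem_partialFractions hc hy) hv
        have h := zpow_mem_partialFractions (k := k) (x := x) (y := y) (-1 + n)
        rwa [zpow_add, zpow_neg_one, Units.val_mul] at h
      · exact mul_mem_partialFractions (mul_zpow_mem_partialFractions hc hy i)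
          (mul_pow_mem_partialFractions hcc hy i) hv
    | algebraMap r =>
      intro v hv
      rw [← Algebra.smul_def]
      exact Submodule.smul_mem _ _ hv
    | add r s _ _ hr hs =>
      intro v hv
      rw [add_mul]
      exact add_mem (hr v hv) (hs v hv)
    | mul r s _ _ hr hs =>
      intro v hv
      rw [mul_assoc]
      exact hr _ (hs v hv)
  refine eq_top_iff.2 fun r _ => ?_
  simpa using key r (htop ▸ Algebra.mem_top) 1 one_mem_partialFractions

/-- A localization of `k[x]` away from `d` is generated by `x` and an inverse of `d`. -/
theorem subalgebra_eq_top_of_away [Algebra k[X] R] [IsScalarTower k k[X] R] (d : k[X])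
    [IsLocalization.Away d R] {T : Subalgebra k R} (hX : algebraMap k[X] R X ∈ T) {e : R}
    (he : e ∈ T) (hde : algebraMap k[X] R d * e = 1) : T = ⊤ := by
  have hp (p : k[X]) : algebraMap k[X] R p ∈ T := by
    have h : algebraMap k[X] R p = aeval (algebraMap k[X] R X) p := by
      rw [Polynomial.aeval_algebraMap_apply, Polynomial.aeval_X_left_apply]
    rw [h]
    exact Algebra.adjoin_le (Set.singleton_subset_iff.2 hX) (aeval_mem_adjoin_singleton _ _)
  refine eq_top_iff.2 fun r _ => ?_
  obtain ⟨n, p, hnp⟩ := IsLocalization.Away.surj d r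
  have h : r = algebraMap k[X] R p * e ^ n := by
    rw [← hnp, mul_assoc, ← mul_pow, hde, one_pow, mul_one]
  rw [h]
  exact mul_mem (hp p) (pow_mem he n)

end PartialFractions

section Generators

variable {k : Type*} [CommRing k] (l : kˣ)

theorem isUnit_xB_mul : IsUnit (xB k * (xB k - 1)) := by
  have h := IsLocalization.Away.algebraMap_isUnit (S := B k) (X * (X - 1) : k[X])
  rwa [map_mul, map_sub, map_one] at h

variable (k) in
/-- The unit `x` of `B`. -/
noncomputable def unitXB : (B k)ˣ := (isUnit_of_mul_isUnit_left (isUnit_xB_mul (k := k))).unit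

variable (k) in
/-- The element `1 / (x - 1)` of `B`. -/
noncomputable def invXSubOneB : B k :=
  ((isUnit_of_mul_isUnit_right (isUnit_xB_mul (k := k))).unit⁻¹ : (B k)ˣ)

/-- The unit `x` of `A`. -/
noncomputable def unitXA : (A l)ˣ := (isUnit_x l).unit

/-- The element `1 / (x - l)` of `A`. -/
noncomputable def invXSub : A l := ((isUnit_x_sub l).unit⁻¹ : (A l)ˣ)

theorem coe_unitXB : (unitXB k : B k) = xB k := rfl

theorem coe_unitXA : (unitXA l : A l) = xA l := rfl

theorem invXSubOneB_mul : invXSubOneB k * (xB k - 1) = 1 := IsUnit.val_inv_mul _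

theorem invXSubOne_mul : invXSubOne l * (xA l - 1) = 1 := IsUnit.val_inv_mul _

theorem invXSub_mul : invXSub l * (xA l - algebraMap k (A l) l) = 1 := IsUnit.val_inv_mul _

theorem partialFractions_B :
    partialFractions k (unitXB k) (fun _ : Unit => invXSubOneB k) = ⊤ := by
  refine partialFractions_eq_top (c := fun _ => 1) (fun _ => isUnit_one)
    (fun i j h => (h (Subsingleton.elim i j)).elim)
    (fun _ => by rw [map_one, coe_unitXB, invXSubOneB_mul]) ?_
  refine subalgebra_eq_top_of_away (X * (X - 1) : k[X])
    (Algebra.subset_adjoin (Or.inl (Or.inl rfl)))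
    (mul_mem (Algebra.subset_adjoin (Or.inl (Or.inr rfl)))
      (Algebra.subset_adjoin (Or.inr ⟨(), rfl⟩))) ?_
  have h₁ : xB k * ((unitXB k)⁻¹ : (B k)ˣ) = 1 := (unitXB k).mul_inv
  have h₂ := invXSubOneB_mul (k := k)
  rw [map_mul, map_sub, map_one]
  change xB k * (xB k - 1) * _ = 1
  linear_combination (xB k - 1) * invXSubOneB k * h₁ + h₂

theorem algebraMap_C_A (c : k) : algebraMap k[X] (A l) (C c) = algebraMap k (A l) c := by
  rw [IsScalarTower.algebraMap_apply k k[X] (A l), Polynomial.algebraMap_eq]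

theorem partialFractions_A (hl : IsUnit (1 - (l : k))) :
    partialFractions k (unitXA l) (fun i : Bool => cond i (invXSubOne l) (invXSub l)) = ⊤ := by
  refine partialFractions_eq_top (c := fun i => cond i 1 (l : k)) ?_ ?_ ?_ ?_
  · rintro (_ | _)
    exacts [l.isUnit, isUnit_one]
  · rintro (_ | _) (_ | _) h
    · exact (h rfl).elim
    · simpa using hl.neg
    · exact hl
    · exact (h rfl).elim
  · rintro (_ | _)
    · exact invXSub_mul l
    · have h := invXSubOne_mul l
      rw [← (algebraMap k (A l)).map_one] at h
      exact h.trans (algebraMap k (A l)).map_one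
  refine subalgebra_eq_top_of_away (X * (X - 1) * (X - C (l : k)) : k[X])
    (Algebra.subset_adjoin (Or.inl (Or.inl rfl)))
    (mul_mem (mul_mem (Algebra.subset_adjoin (Or.inl (Or.inr rfl)))
      (Algebra.subset_adjoin (Or.inr ⟨true, rfl⟩)))
      (Algebra.subset_adjoin (Or.inr ⟨false, rfl⟩))) ?_
  have h₁ : xA l * ((unitXA l)⁻¹ : (A l)ˣ) = 1 := (unitXA l).mul_inv
  have h₂ := invXSubOne_mul l
  have h₃ := invXSub_mul l
  rw [map_mul, map_mul, map_sub, map_sub, map_one, algebraMap_C_A]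
  change xA l * (xA l - 1) * (xA l - algebraMap k (A l) l) *
    (((unitXA l)⁻¹ : (A l)ˣ) * invXSubOne l * invXSub l) = 1
  linear_combination (xA l - 1) * invXSubOne l * (xA l - algebraMap k (A l) l) * invXSub l * h₁ +
    (xA l - algebraMap k (A l) l) * invXSub l * h₂ + h₃

/-! ### The twisted differences -/

theorem f_zpow (n : ℤ) : f l ((unitXB k ^ n : (B k)ˣ) : B k) = ((unitXA l ^ n : (A l)ˣ) : A l) := by
  have h : Units.map (f l : B k →* A l) (unitXB k) = unitXA l := Units.ext (f_xB l)
  rw [← h, ← map_zpow]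
  rfl

theorem g_zpow (n : ℤ) : g l ((unitXB k ^ n : (B k)ˣ) : B k) =
    ((l ^ (-n) : kˣ) : k) • ((unitXA l ^ n : (A l)ˣ) : A l) := by
  have h : Units.map (g l : B k →* A l) (unitXB k) =
      Units.map (algebraMap k (A l) : k →* A l) l⁻¹ * unitXA l :=
    Units.ext ((g_xB l).trans (Algebra.smul_def _ _))
  have h' := congrArg (fun u => ((u ^ n : (A l)ˣ) : A l)) h
  simp only [← map_zpow, mul_zpow, inv_zpow', Units.val_mul] at h'
  rw [Algebra.smul_def]
  exact h'

theorem f_invXSubOneB : f l (invXSubOneB k) = invXSubOne l := by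
  refine (isUnit_x_sub_one l).mul_right_cancel ?_
  have h := congrArg (f l) (invXSubOneB_mul (k := k))
  rw [map_mul, map_sub, map_one, f_xB] at h
  rw [h, invXSubOne_mul]

theorem g_invXSubOneB : g l (invXSubOneB k) = (l : k) • invXSub l := by
  have h := congrArg (g l) (invXSubOneB_mul (k := k))
  rw [map_mul, map_sub, map_one, g_xB] at h
  have h₁ : algebraMap k (A l) l * algebraMap k (A l) ((l⁻¹ : kˣ) : k) = 1 := by
    rw [← map_mul, Units.mul_inv, map_one]
  have h₂ := invXSub_mul l
  refine (isUnit_inv_smul_x_sub_one l).mul_right_cancel ?_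
  rw [h, Algebra.smul_def, Algebra.smul_def]
  linear_combination -h₂ - invXSub l * xA l * h₁

/-- The twisted difference of the Laurent monomial `x ^ n`. -/
theorem twisted_zpow (n : ℤ) :
    f l ((unitXB k ^ n : (B k)ˣ) : B k) - (l : k) • g l ((unitXB k ^ n : (B k)ˣ) : B k) =
      (1 - ((l ^ (1 - n) : kˣ) : k)) • ((unitXA l ^ n : (A l)ˣ) : A l) := by
  rw [f_zpow, g_zpow, smul_smul, ← Units.val_mul, sub_smul, one_smul, ← zpow_one_add,
    ← sub_eq_add_neg]

/-- The twisted difference of `1 / (x - 1) ^ N`. -/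
theorem twisted_pow (N : ℕ) :
    f l (invXSubOneB k ^ N) - (l : k) • g l (invXSubOneB k ^ N) =
      invXSubOne l ^ N - (l : k) ^ (N + 1) • invXSub l ^ N := by
  rw [map_pow, map_pow, f_invXSubOneB, g_invXSubOneB, _root_.smul_pow, smul_smul,
    ← pow_succ']

/-- To show that the twisted differences lie in a submodule, it is enough to look at those of the
partial fractions in `B`. -/
theorem twistedDifferences_le {S : Submodule k (A l)}
    (h₁ : ∀ n : ℤ, (1 - ((l ^ (1 - n) : kˣ) : k)) • ((unitXA l ^ n : (A l)ˣ) : A l) ∈ S)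
    (h₂ : ∀ N : ℕ+, invXSubOne l ^ (N : ℕ) - (l : k) ^ (N + 1 : ℕ) • invXSub l ^ (N : ℕ) ∈ S) :
    twistedDifferences l ≤ S := by
  rw [twistedDifferences, LinearMap.range_eq_map, Submodule.map_le_iff_le_comap,
    ← partialFractions_B]
  refine sup_le (Submodule.span_le.2 ?_) (iSup_le fun i => Submodule.span_le.2 ?_)
  · rintro _ ⟨n, rfl⟩
    have h := h₁ n
    rwa [← twisted_zpow] at h
  · rintro _ ⟨N, rfl⟩
    have h := h₂ N
    rwa [← twisted_pow] at h

end Generators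

/-! ### Laurent expansions -/

section Laurent

variable {k : Type*} [CommRing k]

variable (k) in
/-- The Laurent series without pole. -/
noncomputable def poleFree : Subring (LaurentSeries k) :=
  (HahnSeries.ofPowerSeries ℤ k).range

theorem algebraMap_laurentSeries (r : k) : algebraMap k (LaurentSeries k) r = HahnSeries.C r :=
  HahnSeries.ofPowerSeries_C r

theorem coe_mem_poleFree (w : PowerSeries k) : HahnSeries.ofPowerSeries ℤ k w ∈ poleFree k :=
  ⟨w, rfl⟩

theorem coeff_eq_zero_of_mem_poleFree {z : LaurentSeries k} (hz : z ∈ poleFree k) {n : ℤ}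
    (hn : n < 0) : z.coeff n = 0 := by
  obtain ⟨w, rfl⟩ := hz
  exact (PowerSeries.coeff_coe w n).trans (if_pos hn)

/-- The quotient of a power series by one with invertible constant coefficient is without pole. -/
theorem mem_poleFree_of_mul_mem {w : PowerSeries k} (hw : IsUnit (PowerSeries.constantCoeff w))
    {z : LaurentSeries k} (h : HahnSeries.ofPowerSeries ℤ k w * z ∈ poleFree k) :
    z ∈ poleFree k := by
  obtain ⟨u, rfl⟩ := PowerSeries.isUnit_iff_constantCoeff.2 hw
  have h' := mul_mem (coe_mem_poleFree ((u⁻¹ : (PowerSeries k)ˣ) : PowerSeries k)) h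
  rwa [← mul_assoc, ← map_mul, Units.inv_mul, map_one, one_mul] at h'

theorem single_neg_mul_single (n : ℤ) :
    (HahnSeries.single (-n) 1 : LaurentSeries k) * HahnSeries.single n 1 = 1 := by
  rw [HahnSeries.single_mul_single, neg_add_cancel, mul_one, HahnSeries.single_zero_one]

theorem isUnit_single (n : ℤ) : IsUnit (HahnSeries.single n 1 : LaurentSeries k) :=
  IsUnit.of_mul_eq_one_right _ (single_neg_mul_single n)

theorem val_zpow_eq_single {u : (LaurentSeries k)ˣ} {m : ℤ}
    (hu : (u : LaurentSeries k) = HahnSeries.single m 1) (n : ℤ) :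
    ((u ^ n : (LaurentSeries k)ˣ) : LaurentSeries k) = HahnSeries.single (n * m) 1 := by
  have hinv : ((u⁻¹ : (LaurentSeries k)ˣ) : LaurentSeries k) = HahnSeries.single (-m) 1 :=
    Units.inv_eq_of_mul_eq_one_left (by rw [hu, single_neg_mul_single])
  cases n with
  | ofNat n =>
    rw [Int.ofNat_eq_natCast, zpow_natCast, Units.val_pow_eq_pow_val, hu, HahnSeries.single_pow,
      one_pow, nsmul_eq_mul]
  | negSucc n =>
    rw [zpow_negSucc, ← inv_pow, Units.val_pow_eq_pow_val, hinv, HahnSeries.single_pow, one_pow,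
      nsmul_eq_mul, Int.negSucc_eq]
    congr 1
    push_cast
    ring_nf

/-- The power series `c - d + T`, which is `x - d` in terms of the parameter `T = x - c`. -/
noncomputable def shift (c d : k) : PowerSeries k := PowerSeries.C (c - d) + PowerSeries.X

theorem isUnit_constantCoeff_shift {c d : k} (h : IsUnit (c - d)) :
    IsUnit (PowerSeries.constantCoeff (shift c d)) := by
  simpa [shift] using h

theorem coe_shift (c d : k) : HahnSeries.ofPowerSeries ℤ k (shift c d) =
    algebraMap k (LaurentSeries k) c + HahnSeries.single 1 1 - algebraMap k (LaurentSeries k) d := by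
  rw [shift, map_add, HahnSeries.ofPowerSeries_C, HahnSeries.ofPowerSeries_X, map_sub,
    algebraMap_laurentSeries, algebraMap_laurentSeries]
  ring

variable (l : kˣ)

/-- The algebra map from `A` to Laurent series that substitutes `t` for `x`. -/
noncomputable def expand (t : LaurentSeries k)
    (ht : IsUnit (t * (t - 1) * (t - algebraMap k (LaurentSeries k) l))) :
    A l →ₐ[k] LaurentSeries k :=
  IsLocalization.liftAlgHom (M := Submonoid.powers (X * (X - 1) * (X - C (l : k)) : k[X]))
    (f := aeval t) (by
      rintro ⟨y, n, rfl⟩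
      simp only [map_pow, map_mul, map_sub, aeval_X, map_one, aeval_C]
      exact ht.pow n)

theorem expand_xA (t : LaurentSeries k)
    (ht : IsUnit (t * (t - 1) * (t - algebraMap k (LaurentSeries k) l))) :
    expand l t ht (xA l) = t := by
  simp [expand, xA]

variable {l}

/-- The coefficient of `T ^ n` in the expansion `ψ`. -/
noncomputable def expansionCoeff (ψ : A l →ₐ[k] LaurentSeries k) (n : ℤ) : A l →ₗ[k] k where
  toFun a := (ψ a).coeff n
  map_add' a b := by rw [map_add, HahnSeries.coeff_add]
  map_smul' r a := by
    rw [Algebra.smul_def, map_mul, AlgHom.commutes, algebraMap_laurentSeries, HahnSeries.C_apply,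
      HahnSeries.coeff_single_zero_mul]
    rfl

theorem expansionCoeff_apply (ψ : A l →ₐ[k] LaurentSeries k) (n : ℤ) (a : A l) :
    expansionCoeff ψ n a = (ψ a).coeff n := rfl

section FinitePoint

variable {ψ : A l →ₐ[k] LaurentSeries k} {c : k}

theorem expansion_sub (hψ : ψ (xA l) = algebraMap k (LaurentSeries k) c + HahnSeries.single 1 1)
    (d : k) : ψ (xA l - algebraMap k (A l) d) = HahnSeries.ofPowerSeries ℤ k (shift c d) := by
  rw [map_sub, hψ, AlgHom.commutes, coe_shift]

theorem expansion_polynomial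
    (hψ : ψ (xA l) = algebraMap k (LaurentSeries k) c + HahnSeries.single 1 1) (p : k[X]) :
    ψ (algebraMap k[X] (A l) p) = HahnSeries.ofPowerSeries ℤ k (aeval (shift c 0) p) := by
  have h : (ψ : A l →+* LaurentSeries k).comp (algebraMap k[X] (A l)) =
      (HahnSeries.ofPowerSeries ℤ k).comp
        (aeval (R := k) (shift c 0) : k[X] →+* PowerSeries k) := by
    refine Polynomial.ringHom_ext (fun r => ?_) ?_
    · simp only [RingHom.comp_apply, RingHom.coe_coe, algebraMap_C_A, AlgHom.commutes, aeval_C]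
      rw [algebraMap_laurentSeries, ← PowerSeries.C_eq_algebraMap, HahnSeries.ofPowerSeries_C]
    · have h := expansion_sub hψ 0
      rw [map_zero, sub_zero] at h
      simp only [RingHom.comp_apply, RingHom.coe_coe, aeval_X]
      exact h
  exact DFunLike.congr_fun h p

/-- A fraction `1 / (x - d)` with `c - d` invertible has no pole at `c`. -/
theorem expansion_inv_mem
    (hψ : ψ (xA l) = algebraMap k (LaurentSeries k) c + HahnSeries.single 1 1) {d : k}
    (hcd : IsUnit (c - d)) {y : A l} (hy : y * (xA l - algebraMap k (A l) d) = 1) :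
    ψ y ∈ poleFree k := by
  refine mem_poleFree_of_mul_mem (isUnit_constantCoeff_shift hcd) ?_
  rw [← expansion_sub hψ, ← map_mul, mul_comm, hy, map_one]
  exact one_mem _

theorem expansion_zpow_mem
    (hψ : ψ (xA l) = algebraMap k (LaurentSeries k) c + HahnSeries.single 1 1) (hc : IsUnit c)
    (n : ℤ) : ψ ((unitXA l ^ n : (A l)ˣ) : A l) ∈ poleFree k := by
  cases n with
  | ofNat n =>
    rw [Int.ofNat_eq_natCast, zpow_natCast, Units.val_pow_eq_pow_val, map_pow]
    refine pow_mem ?_ n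
    have h := expansion_polynomial hψ X
    exact h ▸ coe_mem_poleFree _
  | negSucc n =>
    rw [zpow_negSucc, ← inv_pow, Units.val_pow_eq_pow_val, map_pow]
    refine pow_mem (expansion_inv_mem hψ (d := 0) (by rwa [sub_zero]) ?_) _
    rw [map_zero, sub_zero]
    exact (unitXA l).inv_mul

theorem expansion_inv_pow
    (hψ : ψ (xA l) = algebraMap k (LaurentSeries k) c + HahnSeries.single 1 1) {y : A l}
    (hy : y * (xA l - algebraMap k (A l) c) = 1) (N : ℕ) :
    ψ (y ^ N) = HahnSeries.single (-N : ℤ) 1 := by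
  have h : ψ y = HahnSeries.single (-1) 1 := by
    have h₁ := congrArg ψ hy
    rw [map_mul, map_one, map_sub, hψ, AlgHom.commutes, add_sub_cancel_left] at h₁
    exact (isUnit_single 1).mul_right_cancel (h₁.trans (single_neg_mul_single 1).symm)
  rw [map_pow, h, HahnSeries.single_pow, one_pow, nsmul_eq_mul, mul_neg_one]

/-- Elements that are regular at `c` have no pole in their expansion at `c`. -/
theorem expansion_mem_of_regularAt
    (hψ : ψ (xA l) = algebraMap k (LaurentSeries k) c + HahnSeries.single 1 1) {a : A l}
    (ha : a ∈ regularAt (A l) c) : ψ a ∈ poleFree k := by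
  obtain ⟨p, q, hq, h⟩ := ha
  have hcoeff : PowerSeries.constantCoeff (aeval (shift c 0) q) = q.eval c := by
    have h : (PowerSeries.constantCoeff (R := k)).comp
        (aeval (R := k) (shift c 0) : k[X] →+* PowerSeries k) = evalRingHom c :=
      Polynomial.ringHom_ext (by intro r; simp) (by simp [shift])
    exact DFunLike.congr_fun h q
  refine mem_poleFree_of_mul_mem (w := aeval (shift c 0) q) (hcoeff ▸ hq) ?_
  rw [← expansion_polynomial hψ, ← map_mul, h, expansion_polynomial hψ]
  exact coe_mem_poleFree _

end FinitePoint

variable (l) in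
/-- If `1 - l` is invertible, elements of `A` can be expanded at the points `1` and `l`. -/
theorem exists_expansion (hl : IsUnit (1 - (l : k))) {c : k} (hc : c = 1 ∨ c = l) :
    ∃ ψ : A l →ₐ[k] LaurentSeries k,
      ψ (xA l) = algebraMap k (LaurentSeries k) c + HahnSeries.single 1 1 := by
  refine ⟨expand l _ ?_, expand_xA l _ _⟩
  have key {d : k} (h : IsUnit (c - d)) : IsUnit (algebraMap k (LaurentSeries k) c +
      HahnSeries.single 1 1 - algebraMap k (LaurentSeries k) d) := by
    rw [← coe_shift]
    exact (PowerSeries.isUnit_iff_constantCoeff.2 (isUnit_constantCoeff_shift h)).map _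
  have h0 : IsUnit c := by
    rcases hc with rfl | rfl
    exacts [isUnit_one, l.isUnit]
  have k0 := key (d := 0) (by rwa [sub_zero])
  rw [map_zero, sub_zero] at k0
  have hs := isUnit_single (k := k) 1
  rcases hc with rfl | rfl
  · refine (k0.mul ?_).mul (key hl)
    rwa [(algebraMap k (LaurentSeries k)).map_one, add_sub_cancel_left]
  · refine (k0.mul ?_).mul ?_
    · have h := key (d := 1) (by simpa using hl.neg)
      rwa [(algebraMap k (LaurentSeries k)).map_one] at h
    · rwa [add_sub_cancel_left]

theorem isUnit_constantCoeff_one_sub (c : k) :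
    IsUnit (PowerSeries.constantCoeff (1 - PowerSeries.C c * PowerSeries.X)) := by
  simp

/-- In terms of the parameter `T = 1 / x` at infinity, `x - c` is `T⁻¹ (1 - c T)`. -/
theorem single_sub_algebraMap_eq (c : k) :
    HahnSeries.single (-1) 1 * HahnSeries.ofPowerSeries ℤ k
      (1 - PowerSeries.C c * PowerSeries.X) =
      (HahnSeries.single (-1) 1 : LaurentSeries k) - algebraMap k (LaurentSeries k) c := by
  have h := single_neg_mul_single (k := k) 1
  rw [map_sub, (HahnSeries.ofPowerSeries ℤ k).map_one, map_mul, HahnSeries.ofPowerSeries_C, HahnSeries.ofPowerSeries_X,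
    algebraMap_laurentSeries]
  linear_combination -HahnSeries.C c * h

variable (l) in
/-- Elements of `A` can be expanded at infinity. -/
theorem exists_expansion_infinity :
    ∃ ψ : A l →ₐ[k] LaurentSeries k, ψ (xA l) = HahnSeries.single (-1) 1 := by
  refine ⟨expand l _ ?_, expand_xA l _ _⟩
  have key (c : k) : IsUnit ((HahnSeries.single (-1) 1 : LaurentSeries k) -
      algebraMap k (LaurentSeries k) c) := by
    rw [← single_sub_algebraMap_eq]
    exact (isUnit_single _).mul ((PowerSeries.isUnit_iff_constantCoeff.2
      (isUnit_constantCoeff_one_sub c)).map _)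
  have k1 := key 1
  rw [(algebraMap k (LaurentSeries k)).map_one] at k1
  exact ((isUnit_single _).mul k1).mul (key l)

section Infinity

variable {ψ : A l →ₐ[k] LaurentSeries k}

theorem expansion_infinity_zpow (hψ : ψ (xA l) = HahnSeries.single (-1) 1) (n : ℤ) :
    ψ ((unitXA l ^ n : (A l)ˣ) : A l) = HahnSeries.single (-n) 1 := by
  have h := val_zpow_eq_single (u := Units.map (ψ : A l →* LaurentSeries k) (unitXA l)) hψ n
  rw [← map_zpow, mul_neg_one] at h
  exact h

/-- A fraction `1 / (x - c)` has no pole at infinity. -/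
theorem expansion_infinity_inv_mem (hψ : ψ (xA l) = HahnSeries.single (-1) 1) {c : k} {y : A l}
    (hy : y * (xA l - algebraMap k (A l) c) = 1) : ψ y ∈ poleFree k := by
  refine mem_poleFree_of_mul_mem (isUnit_constantCoeff_one_sub c) ?_
  have h₁ := congrArg ψ hy
  rw [map_mul, map_sub, map_one, hψ, AlgHom.commutes, ← single_sub_algebraMap_eq] at h₁
  have h₂ := single_neg_mul_single (k := k) 1
  have h₃ : HahnSeries.ofPowerSeries ℤ k (1 - PowerSeries.C c * PowerSeries.X) * ψ y =
      HahnSeries.ofPowerSeries ℤ k PowerSeries.X := by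
    rw [HahnSeries.ofPowerSeries_X]
    linear_combination HahnSeries.single 1 1 * h₁ -
      ψ y * HahnSeries.ofPowerSeries ℤ k (1 - PowerSeries.C c * PowerSeries.X) * h₂
  rw [h₃]
  exact coe_mem_poleFree _

end Infinity

end Laurent

/-! ### Dual families -/

section Dual

variable {k M ι : Type*} [CommRing k] [AddCommGroup M] [Module k M]

theorem eq_zero_of_mem_span_of_dual [DecidableEq ι] {x : ι → M} {φ : ι → M →ₗ[k] k}
    (h : ∀ i j, φ i (x j) = if i = j then 1 else 0) {v : M}
    (hv : v ∈ Submodule.span k (Set.range x)) (h0 : ∀ i, φ i v = 0) : v = 0 := by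
  obtain ⟨c, rfl⟩ := Finsupp.mem_span_range_iff_exists_finsupp.1 hv
  have hc : c = 0 := by
    ext i
    have hi := h0 i
    simp only [Finsupp.sum, map_sum, map_smul, h, smul_eq_mul, mul_ite, mul_one, mul_zero] at hi
    rw [Finset.sum_ite_eq] at hi
    simpa using hi
  simp [hc]

/-- A module with an infinite family of elements and a dual family of functionals with values in a
field is not finitely generated: `n` generators would give `n` generators of `κ ^ (n + 1)`. -/
theorem not_finite_of_dual (κ : Type*) [Field κ] [Algebra k κ] {x : ℕ → M} {φ : ℕ → M →ₗ[k] κ}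
    (h : ∀ i j, φ i (x j) = if i = j then 1 else 0) : ¬ Module.Finite k M := by
  intro hfin
  obtain ⟨n, s, hs⟩ := Module.Finite.exists_fin (R := k) (M := M)
  let Φ : M →ₗ[k] (Fin (n + 1) → κ) := LinearMap.pi fun i => φ i
  let W : Submodule κ (Fin (n + 1) → κ) := Submodule.span κ (Set.range (Φ ∘ s))
  have hW (m : M) : Φ m ∈ W := by
    have hle : Submodule.span k (Set.range s) ≤ (W.restrictScalars k).comap Φ := by
      rw [Submodule.span_le]
      rintro _ ⟨i, rfl⟩
      exact Submodule.subset_span ⟨i, rfl⟩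
    exact hle (hs ▸ Submodule.mem_top)
  have htop : W = ⊤ := by
    rw [eq_top_iff, ← (Pi.basisFun κ (Fin (n + 1))).span_eq, Submodule.span_le]
    rintro _ ⟨i, rfl⟩
    have hi : Pi.basisFun κ (Fin (n + 1)) i = Φ (x i) := by
      ext j
      simp only [Φ, LinearMap.pi_apply, h, Pi.basisFun_apply, Pi.single_apply, Fin.val_inj]
    exact hi ▸ hW (x i)
  have hrank := finrank_range_le_card (R := κ) (Φ ∘ s)
  rw [Set.finrank] at hrank
  change Module.finrank κ W ≤ _ at hrank
  rw [htop, finrank_top, Module.finrank_fin_fun, Fintype.card_fin] at hrank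
  omega

end Dual

/-! ### The quotient by the twisted differences -/

section Quotient

variable {k : Type*} [CommRing k] (l : kˣ)

/-- The elements `x` and `1 / (x - 1) ^ N` of `A`. -/
noncomputable def representative : Option ℕ+ → A l
  | none => xA l
  | some N => invXSubOne l ^ (N : ℕ)

theorem xA_eq_zpow : xA l = ((unitXA l ^ (1 : ℤ) : (A l)ˣ) : A l) := by
  rw [zpow_one, coe_unitXA]

theorem inv_pow_succ_mul_pow_succ (N : ℕ) : ((l⁻¹ ^ (N + 1) : kˣ) : k) * (l : k) ^ (N + 1) = 1 := by
  rw [← Units.val_pow_eq_pow_val, ← Units.val_mul, ← mul_pow, inv_mul_cancel, one_pow,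
    Units.val_one]

theorem expansionCoeff_inv_pow {l : kˣ} {ψ : A l →ₐ[k] LaurentSeries k} {c : k}
    (hψ : ψ (xA l) = algebraMap k (LaurentSeries k) c + HahnSeries.single 1 1) {y : A l}
    (hy : y * (xA l - algebraMap k (A l) c) = 1) (M N : ℕ+) :
    expansionCoeff ψ (-(M : ℕ) : ℤ) (y ^ (N : ℕ)) = if M = N then 1 else 0 := by
  rw [expansionCoeff_apply, expansion_inv_pow hψ hy, HahnSeries.coeff_single]
  simp

theorem expansionCoeff_eq_zero {l : kˣ} {ψ : A l →ₐ[k] LaurentSeries k} {a : A l}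
    (h : ψ a ∈ poleFree k) (M : ℕ+) : expansionCoeff ψ (-(M : ℕ) : ℤ) a = 0 :=
  coeff_eq_zero_of_mem_poleFree h (by have := M.pos; omega)

theorem invXSubOne_mul' : invXSubOne l * (xA l - algebraMap k (A l) 1) = 1 := by
  rw [(algebraMap k (A l)).map_one, invXSubOne_mul]

theorem expansionCoeff_infinity_zpow {l : kˣ} {ψ : A l →ₐ[k] LaurentSeries k}
    (hψ : ψ (xA l) = HahnSeries.single (-1) 1) (m n : ℤ) :
    expansionCoeff ψ (-m) ((unitXA l ^ n : (A l)ˣ) : A l) = if m = n then 1 else 0 := by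
  rw [expansionCoeff_apply, expansion_infinity_zpow hψ, HahnSeries.coeff_single]
  simp

theorem expansionCoeff_infinity_inv_pow {l : kˣ} {ψ : A l →ₐ[k] LaurentSeries k}
    (hψ : ψ (xA l) = HahnSeries.single (-1) 1) {c : k} {y : A l}
    (hy : y * (xA l - algebraMap k (A l) c) = 1) (N : ℕ) {m : ℤ} (hm : 0 < m) :
    expansionCoeff ψ (-m) (y ^ N) = 0 := by
  rw [expansionCoeff_apply, map_pow]
  exact coeff_eq_zero_of_mem_poleFree (pow_mem (expansion_infinity_inv_mem hψ hy) N) (by omega)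

/-- If `1 - l` is invertible, there are functionals on `A` modulo the twisted differences that are
dual to `x` and the `1 / (x - 1) ^ N`: for `x` the coefficient of `x` in the expansion at infinity,
and for `1 / (x - 1) ^ N` the sum of the coefficient of `1 / (x - 1) ^ N` at the point `1` and of
`l ^ (-N - 1)` times that of `1 / (x - l) ^ N` at the point `l`. -/
theorem exists_dual (hl : IsUnit (1 - (l : k))) :
    ∃ Ξ : Option ℕ+ → (A l ⧸ twistedDifferences l) →ₗ[k] k,
      ∀ i j, Ξ i (Submodule.Quotient.mk (representative l j)) = if i = j then 1 else 0 := by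
  obtain ⟨ψ, hψ⟩ := exists_expansion_infinity l
  obtain ⟨ψ₁, h₁⟩ := exists_expansion l hl (c := 1) (Or.inl rfl)
  obtain ⟨ψ₂, h₂⟩ := exists_expansion l hl (c := l) (Or.inr rfl)
  have hl' : IsUnit ((l : k) - 1) := by simpa using hl.neg
  let Θ : Option ℕ+ → A l →ₗ[k] k
    | none => expansionCoeff ψ (-1)
    | some M => expansionCoeff ψ₁ (-(M : ℕ) : ℤ) +
        ((l⁻¹ ^ (M + 1 : ℕ) : kˣ) : k) • expansionCoeff ψ₂ (-(M : ℕ) : ℤ)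
  have z₁ (M : ℕ+) (n : ℤ) := expansionCoeff_eq_zero (expansion_zpow_mem h₁ isUnit_one n) M
  have z₂ (M : ℕ+) (n : ℤ) := expansionCoeff_eq_zero (expansion_zpow_mem h₂ l.isUnit n) M
  have p₁ (M N : ℕ+) := expansionCoeff_inv_pow h₁ (invXSubOne_mul' l) M N
  have p₂ (M N : ℕ+) : expansionCoeff ψ₂ (-(M : ℕ) : ℤ) (invXSubOne l ^ (N : ℕ)) = 0 := by
    refine expansionCoeff_eq_zero ?_ M
    rw [map_pow]
    exact pow_mem (expansion_inv_mem h₂ hl' (invXSubOne_mul' l)) _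
  have q₁ (M N : ℕ+) : expansionCoeff ψ₁ (-(M : ℕ) : ℤ) (invXSub l ^ (N : ℕ)) = 0 := by
    refine expansionCoeff_eq_zero ?_ M
    rw [map_pow]
    exact pow_mem (expansion_inv_mem h₁ hl (invXSub_mul l)) _
  have q₂ (M N : ℕ+) := expansionCoeff_inv_pow h₂ (invXSub_mul l) M N
  have hΘ (i : Option ℕ+) : twistedDifferences l ≤ LinearMap.ker (Θ i) := by
    refine twistedDifferences_le l (fun n => ?_) (fun N => ?_)
    · rw [LinearMap.mem_ker, map_smul]
      rcases i with _ | M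
      · change _ • expansionCoeff ψ (-1) _ = 0
        rw [expansionCoeff_infinity_zpow hψ]
        split_ifs with h
        · simp [← h]
        · rw [smul_zero]
      · simp [Θ, z₁, z₂]
    · rw [LinearMap.mem_ker, map_sub, map_smul]
      rcases i with _ | M
      · change expansionCoeff ψ (-1) _ - _ • expansionCoeff ψ (-1) _ = 0
        rw [expansionCoeff_infinity_inv_pow hψ (invXSubOne_mul' l) _ one_pos,
          expansionCoeff_infinity_inv_pow hψ (invXSub_mul l) _ one_pos, smul_zero, sub_zero]
      · simp only [Θ, LinearMap.add_apply, LinearMap.smul_apply, p₁, p₂, q₁, q₂, smul_eq_mul]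
        split_ifs with h
        · rw [h]
          linear_combination -inv_pow_succ_mul_pow_succ l N
        · simp
  refine ⟨fun i => (twistedDifferences l).liftQ (Θ i) (hΘ i), fun i j => ?_⟩
  change Θ i (representative l j) = _
  rcases i with _ | M <;> rcases j with _ | N <;> simp only [representative]
  · rw [xA_eq_zpow]
    exact expansionCoeff_infinity_zpow hψ 1 1
  · exact expansionCoeff_infinity_inv_pow hψ (invXSubOne_mul' l) _ one_pos
  · simp only [xA_eq_zpow, Θ, LinearMap.add_apply, LinearMap.smul_apply, z₁, z₂, smul_zero,
      add_zero]
    rfl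
  · simp [Θ, p₁, p₂]

/-- The quotient of `A` by the twisted differences is not finitely generated. If `1 - l` is
invertible this is seen by the classes of the `1 / (x - 1) ^ N`. Otherwise `l = 1` modulo a maximal
ideal `m`, all coefficients at infinity of twisted differences in positive powers of `x` lie in `m`,
and the classes of the `x ^ n` are independent modulo `m`. -/
theorem not_finite_quotient (hl1 : l ≠ 1) : ¬ Module.Finite k (A l ⧸ twistedDifferences l) := by
  by_cases hl : IsUnit (1 - (l : k))
  · have : Nontrivial k := ⟨l, 1, fun h => hl1 (Units.ext h)⟩
    obtain ⟨m, hm⟩ := Ideal.exists_maximal k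
    let _ : Field (k ⧸ m) := Ideal.Quotient.field m
    obtain ⟨Ξ, hΞ⟩ := exists_dual l hl
    refine not_finite_of_dual (k ⧸ m)
      (x := fun i => Submodule.Quotient.mk (representative l (some i.succPNat)))
      (φ := fun i => Algebra.linearMap k (k ⧸ m) ∘ₗ Ξ (some i.succPNat)) fun i j => ?_
    rw [LinearMap.comp_apply, hΞ]
    simp only [Option.some_inj, Nat.succPNat_inj]
    split_ifs <;> simp
  · obtain ⟨m, hm, hlm⟩ := exists_max_ideal_of_mem_nonunits hl
    let _ : Field (k ⧸ m) := Ideal.Quotient.field m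
    have hl1 : Units.map (Ideal.Quotient.mk m : k →* k ⧸ m) l = 1 :=
      Units.ext ((Ideal.Quotient.mk_eq_mk_iff_sub_mem _ _).2 hlm).symm
    have hpow (n : ℤ) : 1 - ((l ^ n : kˣ) : k) ∈ m := by
      have h : Units.map (Ideal.Quotient.mk m : k →* k ⧸ m) (l ^ n) = 1 := by
        rw [map_zpow, hl1, one_zpow]
      exact (Ideal.Quotient.mk_eq_mk_iff_sub_mem _ _).1 (congrArg Units.val h).symm
    obtain ⟨ψ, hψ⟩ := exists_expansion_infinity l
    let φ (i : ℕ) : A l →ₗ[k] k ⧸ m :=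
      Algebra.linearMap k (k ⧸ m) ∘ₗ expansionCoeff ψ (-((i : ℤ) + 1))
    have hφ (i : ℕ) : twistedDifferences l ≤ LinearMap.ker (φ i) := by
      refine twistedDifferences_le l (fun n => ?_) (fun N => ?_)
      · rw [LinearMap.mem_ker, LinearMap.comp_apply, map_smul, smul_eq_mul,
          Algebra.linearMap_apply, map_mul]
        exact mul_eq_zero_of_left (Ideal.Quotient.eq_zero_iff_mem.2 (hpow _)) _
      · have hi : (0 : ℤ) < i + 1 := by omega
        rw [LinearMap.mem_ker, LinearMap.comp_apply, map_sub, map_smul,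
          expansionCoeff_infinity_inv_pow hψ (invXSubOne_mul' l) _ hi,
          expansionCoeff_infinity_inv_pow hψ (invXSub_mul l) _ hi, smul_zero, sub_zero, map_zero]
    refine not_finite_of_dual (k ⧸ m)
      (x := fun i => Submodule.Quotient.mk ((unitXA l ^ ((i : ℤ) + 1) : (A l)ˣ) : A l))
      (φ := fun i => (twistedDifferences l).liftQ (φ i) (hφ i)) fun i j => ?_
    change φ i _ = _
    rw [LinearMap.comp_apply, expansionCoeff_infinity_zpow hψ]
    simp only [add_left_inj, Nat.cast_inj]
    split_ifs <;> simp

/-! ### Laurent polynomials and regular elements -/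

/-- The span of the Laurent monomials `x ^ n` in `A`. -/
noncomputable def laurentA : Submodule k (A l) :=
  Submodule.span k (Set.range fun n : ℤ => ((unitXA l ^ n : (A l)ˣ) : A l))

variable (k) in
/-- The span of the Laurent monomials `x ^ n` in `B`. -/
noncomputable def laurentB : Submodule k (B k) :=
  Submodule.span k (Set.range fun n : ℤ => ((unitXB k ^ n : (B k)ˣ) : B k))

theorem zpow_mem_regularAt {R : Type*} [CommRing R] [Algebra k R] [Algebra k[X] R]
    [IsScalarTower k k[X] R] {u : Rˣ} (hu : (u : R) = algebraMap k[X] R X) {c : k}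
    (hc : IsUnit c) (n : ℤ) : ((u ^ n : Rˣ) : R) ∈ regularAt R c := by
  cases n with
  | ofNat n =>
    refine ⟨X ^ n, 1, by simp, ?_⟩
    rw [map_one, one_mul, Int.ofNat_eq_natCast, zpow_natCast, Units.val_pow_eq_pow_val, hu,
      map_pow]
  | negSucc n =>
    refine ⟨1, X ^ (n + 1), by simpa using hc.pow (n + 1), ?_⟩
    rw [map_one, map_pow, ← hu, zpow_negSucc, ← Units.val_pow_eq_pow_val, Units.mul_inv]

theorem laurentA_le_regularAt {c : k} (hc : IsUnit c) : laurentA l ≤ regularAt (A l) c := by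
  rw [laurentA, Submodule.span_le]
  rintro _ ⟨n, rfl⟩
  exact zpow_mem_regularAt rfl hc n

theorem laurentB_le_regularAt {c : k} (hc : IsUnit c) : laurentB k ≤ regularAt (B k) c := by
  rw [laurentB, Submodule.span_le]
  rintro _ ⟨n, rfl⟩
  exact zpow_mem_regularAt rfl hc n

theorem map_f_laurentB : (laurentB k).map (f l).toLinearMap ≤ laurentA l := by
  rw [laurentB, Submodule.map_span_le]
  rintro _ ⟨n, rfl⟩
  exact Submodule.subset_span ⟨n, (f_zpow l n).symm⟩

/-- Partial fractions in `A`, grouped by their poles. -/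
theorem exists_laurent_add_poles (hl : IsUnit (1 - (l : k))) (a : A l) :
    ∃ u ∈ laurentA l, ∃ v ∈ Submodule.span k (Set.range fun N : ℕ+ => invXSubOne l ^ (N : ℕ)),
      ∃ w ∈ Submodule.span k (Set.range fun N : ℕ+ => invXSub l ^ (N : ℕ)), a = u + v + w := by
  have ha : a ∈ partialFractions k (unitXA l)
      (fun i : Bool => cond i (invXSubOne l) (invXSub l)) :=
    partialFractions_A l hl ▸ Submodule.mem_top
  rw [partialFractions, iSup_bool_eq] at ha
  obtain ⟨u, hu, z, hz, rfl⟩ := Submodule.mem_sup.1 ha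
  obtain ⟨v, hv, w, hw, rfl⟩ := Submodule.mem_sup.1 hz
  exact ⟨u, hu, v, hv, w, hw, (add_assoc _ _ _).symm⟩

/-- The elements of `A` that are regular at `1` and `l` are the Laurent polynomials. -/
theorem mem_laurentA_iff (hl : IsUnit (1 - (l : k))) {a : A l} :
    a ∈ laurentA l ↔ a ∈ regularAt (A l) (1 : k) ∧ a ∈ regularAt (A l) (l : k) := by
  refine ⟨fun h => ⟨laurentA_le_regularAt l isUnit_one h, laurentA_le_regularAt l l.isUnit h⟩,
    fun ⟨ha₁, ha₂⟩ => ?_⟩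
  obtain ⟨ψ₁, h₁⟩ := exists_expansion l hl (c := 1) (Or.inl rfl)
  obtain ⟨ψ₂, h₂⟩ := exists_expansion l hl (c := l) (Or.inr rfl)
  have hl' : IsUnit ((l : k) - 1) := by simpa using hl.neg
  obtain ⟨u, hu, v, hv, w, hw, rfl⟩ := exists_laurent_add_poles l hl a
  have hker {ψ : A l →ₐ[k] LaurentSeries k} {c : k} (hc : IsUnit c)
      (hψ : ψ (xA l) = algebraMap k (LaurentSeries k) c + HahnSeries.single 1 1) (M : ℕ+) :
      expansionCoeff ψ (-(M : ℕ) : ℤ) u = 0 := by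
    have h : laurentA l ≤ LinearMap.ker (expansionCoeff ψ (-(M : ℕ) : ℤ)) := by
      rw [laurentA, Submodule.span_le]
      rintro _ ⟨n, rfl⟩
      exact expansionCoeff_eq_zero (expansion_zpow_mem hψ hc n) M
    exact h hu
  have hother {ψ : A l →ₐ[k] LaurentSeries k} {y z : A l} (hy : ψ y ∈ poleFree k)
      (hz : z ∈ Submodule.span k (Set.range fun N : ℕ+ => y ^ (N : ℕ))) (M : ℕ+) :
      expansionCoeff ψ (-(M : ℕ) : ℤ) z = 0 := by
    have h : Submodule.span k (Set.range fun N : ℕ+ => y ^ (N : ℕ)) ≤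
        LinearMap.ker (expansionCoeff ψ (-(M : ℕ) : ℤ)) := by
      rw [Submodule.span_le]
      rintro _ ⟨n, rfl⟩
      refine expansionCoeff_eq_zero ?_ M
      rw [map_pow]
      exact pow_mem hy _
    exact h hz
  have hv0 : v = 0 := by
    refine eq_zero_of_mem_span_of_dual (expansionCoeff_inv_pow h₁ (invXSubOne_mul' l)) hv
      fun M => ?_
    have h := expansionCoeff_eq_zero (expansion_mem_of_regularAt h₁ ha₁) M
    rwa [map_add, map_add, hker isUnit_one h₁, zero_add,
      hother (expansion_inv_mem h₁ hl (invXSub_mul l)) hw, add_zero] at h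
  have hw0 : w = 0 := by
    refine eq_zero_of_mem_span_of_dual (expansionCoeff_inv_pow h₂ (invXSub_mul l)) hw
      fun M => ?_
    have h := expansionCoeff_eq_zero (expansion_mem_of_regularAt h₂ ha₂) M
    rwa [map_add, map_add, hker l.isUnit h₂, zero_add,
      hother (expansion_inv_mem h₂ hl' (invXSubOne_mul' l)) hv, zero_add] at h
  rwa [hv0, hw0, add_zero, add_zero]

/-! ### The basis -/

variable {l}

theorem isUnit_one_sub_zpow (hpow : ∀ n : ℕ, 0 < n → IsUnit (1 - (l : k) ^ n)) {n : ℤ}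
    (hn : n ≠ 0) : IsUnit (1 - ((l ^ n : kˣ) : k)) := by
  cases n with
  | ofNat n =>
    rw [Int.ofNat_eq_natCast, zpow_natCast, Units.val_pow_eq_pow_val]
    exact hpow n (Nat.pos_of_ne_zero fun h => hn (by simp [h]))
  | negSucc n =>
    have h : 1 - ((l ^ (Int.negSucc n) : kˣ) : k) =
        -(((l ^ (n + 1))⁻¹ : kˣ) : k) * (1 - (l : k) ^ (n + 1)) := by
      rw [zpow_negSucc, ← Units.val_pow_eq_pow_val]
      linear_combination -(l ^ (n + 1)).inv_mul
    rw [h]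
    exact (Units.isUnit _).neg.mul (hpow _ n.succ_pos)

/-- Modulo the twisted differences of Laurent polynomials, every Laurent polynomial is a multiple
of `x`. -/
theorem exists_eq_smul_xA_add (hpow : ∀ n : ℕ, 0 < n → IsUnit (1 - (l : k) ^ n)) {a : A l}
    (ha : a ∈ laurentA l) :
    ∃ r : k, ∃ b ∈ laurentB k, a = r • xA l + (f l b - (l : k) • g l b) := by
  have hle : laurentA l ≤ Submodule.span k {xA l} ⊔
      (laurentB k).map ((f l).toLinearMap - (l : k) • (g l).toLinearMap) := by
    rw [laurentA, Submodule.span_le]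
    rintro _ ⟨n, rfl⟩
    rcases eq_or_ne n 1 with rfl | hn
    · exact (le_sup_left : _ ≤ Submodule.span k {xA l} ⊔ _)
        (Submodule.mem_span_singleton.2 ⟨1, (one_smul k _).trans (xA_eq_zpow l)⟩)
    · have hu := isUnit_one_sub_zpow hpow (sub_ne_zero.2 hn.symm)
      refine (le_sup_right : _ ≤ Submodule.span k {xA l} ⊔ _)
        ((Submodule.smul_mem_iff_of_isUnit _ hu).1 ?_)
      rw [← twisted_zpow]
      exact ⟨_, Submodule.subset_span ⟨n, rfl⟩, rfl⟩
  obtain ⟨y, hy, z, ⟨b, hb, rfl⟩, rfl⟩ := Submodule.mem_sup.1 (hle ha)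
  obtain ⟨r, rfl⟩ := Submodule.mem_span_singleton.1 hy
  exact ⟨r, b, hb, rfl⟩

theorem span_representative (hpow : ∀ n : ℕ, 0 < n → IsUnit (1 - (l : k) ^ n)) :
    Submodule.span k (Set.range fun i : Option ℕ+ =>
      (Submodule.Quotient.mk (representative l i) : A l ⧸ twistedDifferences l)) = ⊤ := by
  set S := Submodule.span k (Set.range fun i : Option ℕ+ =>
      (Submodule.Quotient.mk (representative l i) : A l ⧸ twistedDifferences l)) with hS
  have hrep (i : Option ℕ+) : representative l i ∈ S.comap (twistedDifferences l).mkQ :=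
    Submodule.subset_span ⟨i, rfl⟩
  have htw {a : A l} (ha : a ∈ twistedDifferences l) : a ∈ S.comap (twistedDifferences l).mkQ := by
    rw [Submodule.mem_comap, Submodule.mkQ_apply, (Submodule.Quotient.mk_eq_zero _).2 ha]
    exact zero_mem _
  have hl : IsUnit (1 - (l : k)) := by simpa using hpow 1 one_pos
  refine eq_top_iff.2 fun c _ => ?_
  obtain ⟨a, rfl⟩ := Submodule.mkQ_surjective _ c
  change a ∈ S.comap (twistedDifferences l).mkQ
  obtain ⟨u, hu, v, hv, w, hw, rfl⟩ := exists_laurent_add_poles l hl a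
  refine add_mem (add_mem ?_ ?_) ?_
  · obtain ⟨r, b, -, rfl⟩ := exists_eq_smul_xA_add hpow hu
    exact add_mem (Submodule.smul_mem _ _ (hrep none)) (htw ⟨b, rfl⟩)
  · refine (Submodule.span_le.2 ?_ : Submodule.span k _ ≤ _) hv
    rintro _ ⟨N, rfl⟩
    exact hrep (some N)
  · refine (Submodule.span_le.2 ?_ : Submodule.span k _ ≤ _) hw
    rintro _ ⟨N, rfl⟩
    have hu : IsUnit ((l : k) ^ (N + 1 : ℕ)) := l.isUnit.pow _
    refine (Submodule.smul_mem_iff_of_isUnit _ hu).1 ?_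
    have h := twisted_pow l (N : ℕ)
    rw [eq_sub_iff_add_eq, ← eq_sub_iff_add_eq'] at h
    rw [h]
    exact sub_mem (hrep (some N)) (htw ⟨_, rfl⟩)

/-- The classes of `x` and the `1 / (x - 1) ^ N` form a basis of `A` modulo the twisted
differences. -/
noncomputable def quotientBasis (hpow : ∀ n : ℕ, 0 < n → IsUnit (1 - (l : k) ^ n)) :
    Module.Basis (Option ℕ+) k (A l ⧸ twistedDifferences l) :=
  Module.Basis.mk (v := fun i => Submodule.Quotient.mk (representative l i))
    (by
      obtain ⟨Ξ, hΞ⟩ := exists_dual l (by simpa using hpow 1 one_pos)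
      exact LinearIndependent.of_pairwise_dual_eq_zero_one _ Ξ
        (fun i j hij => (hΞ i j).trans (if_neg hij)) fun i => (hΞ i i).trans (if_pos rfl))
    (span_representative hpow).ge

theorem quotientBasis_apply (hpow : ∀ n : ℕ, 0 < n → IsUnit (1 - (l : k) ^ n)) (i : Option ℕ+) :
    quotientBasis hpow i = Submodule.Quotient.mk (representative l i) :=
  Module.Basis.mk_apply _ _ i

/-! ### Regular derivations -/

theorem mem_regularPairs_iff (hl : IsUnit (1 - (l : k))) {p : Der (f l) × Der (g l)} :
    p ∈ regularPairs l ↔ p.1.1 (xB k) ∈ laurentA l ∧ p.2.1 (xB k) ∈ laurentA l := by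
  rw [mem_laurentA_iff l hl, mem_laurentA_iff l hl]
  rfl

/-- If a regular pair has `Γ^f(x) - l Γ^g(x)` among the twisted differences, it is the coboundary
of regular derivations: being a Laurent polynomial, `Γ^f(x) - l Γ^g(x)` is a multiple of `x`
plus the twisted difference of a Laurent polynomial, and the multiple is zero because the class
of `x` is part of a basis. -/
theorem mem_map_derCoboundary (hpow : ∀ n : ℕ, 0 < n → IsUnit (1 - (l : k) ^ n))
    {p : Der (f l) × Der (g l)} (hp : p ∈ regularPairs l)
    (h : evalDiff l p ∈ twistedDifferences l) :
    p ∈ (regularDerivations l).map (derCoboundary (f l) (g l)) := by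
  have hl : IsUnit (1 - (l : k)) := by simpa using hpow 1 one_pos
  have hp' := (mem_regularPairs_iff hl).1 hp
  obtain ⟨r, b, hb, hrb⟩ := exists_eq_smul_xA_add hpow
    (a := evalDiff l p) (sub_mem hp'.1 (Submodule.smul_mem _ _ hp'.2))
  have hr : r = 0 := by
    have hx : r • xA l ∈ twistedDifferences l := by
      rw [← add_sub_cancel_right (r • xA l) (f l b - (l : k) • g l b), ← hrb]
      exact sub_mem h ⟨b, rfl⟩
    obtain ⟨Ξ, hΞ⟩ := exists_dual l hl
    have h0 := congrArg (Ξ none) ((Submodule.Quotient.mk_eq_zero _).2 hx)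
    rw [Submodule.Quotient.mk_smul, map_smul, map_zero] at h0
    have h1 := hΞ none none
    rw [if_pos rfl] at h1
    change r • Ξ none (Submodule.Quotient.mk (representative l none)) = 0 at h0
    rwa [h1, smul_eq_mul, mul_one] at h0
  rw [hr, zero_smul, zero_add] at hrb
  have ha : f l b - p.1.1 (xB k) ∈ laurentA l := sub_mem (map_f_laurentB l ⟨b, hb, rfl⟩) hp'.1
  refine ⟨_, ⟨⟨?_, ?_⟩, ?_, ?_⟩, derCoboundary_of_evalDiff_eq l hrb.symm⟩
  · change derB (derB.symm b) ∈ _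
    rw [LinearEquiv.apply_symm_apply]
    exact laurentB_le_regularAt isUnit_one hb
  · change derB (derB.symm b) ∈ _
    rw [LinearEquiv.apply_symm_apply]
    exact laurentB_le_regularAt l.isUnit hb
  · change derA l ((derA l).symm _) ∈ _
    rw [LinearEquiv.apply_symm_apply]
    exact laurentA_le_regularAt l isUnit_one ha
  · change derA l ((derA l).symm _) ∈ _
    rw [LinearEquiv.apply_symm_apply]
    exact laurentA_le_regularAt l l.isUnit ha

theorem derClass_eq_zero_iff {p : Der (f l) × Der (g l)} :
    derClass (f l) (g l) p = 0 ↔ evalDiff l p ∈ twistedDifferences l := by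
  rw [← LinearMap.mem_ker, ker_derClass_eq, Submodule.mem_comap]

theorem regularToH2_injective (hpow : ∀ n : ℕ, 0 < n → IsUnit (1 - (l : k) ^ n)) :
    Function.Injective (regularToH2 l) := by
  rw [injective_iff_map_eq_zero]
  intro c hc
  obtain ⟨p, rfl⟩ := Submodule.mkQ_surjective _ c
  have h : derClass (f l) (g l) p.1 = 0 := hc
  exact (Submodule.Quotient.mk_eq_zero _).2
    (mem_map_derCoboundary hpow p.2 (derClass_eq_zero_iff.1 h))

theorem range_regularToH2 (hpow : ∀ n : ℕ, 0 < n → IsUnit (1 - (l : k) ^ n)) :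
    LinearMap.range (regularToH2 l) =
      Submodule.span k {derClass (f l) (g l) ((derBA (f l)).symm (xA l), 0)} := by
  have hl : IsUnit (1 - (l : k)) := by simpa using hpow 1 one_pos
  have hD : ((derBA (f l)).symm (xA l)).1 (xB k) = xA l := (derBA (f l)).apply_symm_apply _
  apply le_antisymm
  · rintro _ ⟨c, rfl⟩
    obtain ⟨p, rfl⟩ := Submodule.mkQ_surjective _ c
    have hp := (mem_regularPairs_iff hl).1 p.2
    obtain ⟨r, b, -, hrb⟩ := exists_eq_smul_xA_add hpow
      (a := evalDiff l p.1) (sub_mem hp.1 (Submodule.smul_mem _ _ hp.2))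
    refine Submodule.mem_span_singleton.2 ⟨r, ?_⟩
    change _ = derClass (f l) (g l) p.1
    rw [eq_comm, ← sub_eq_zero, ← map_smul, ← map_sub, derClass_eq_zero_iff, map_sub, map_smul,
      hrb, evalDiff_apply, hD]
    refine ⟨b, ?_⟩
    change f l b - (l : k) • g l b = _
    simp
  · rw [Submodule.span_singleton_le_iff_mem]
    refine ⟨Submodule.Quotient.mk ⟨((derBA (f l)).symm (xA l), 0),
      (mem_regularPairs_iff hl).2 ⟨?_, zero_mem _⟩⟩, rfl⟩
    rw [hD]
    exact Submodule.subset_span ⟨1, (xA_eq_zpow l).symm⟩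

theorem exists_basis (hpow : ∀ n : ℕ, 0 < n → IsUnit (1 - (l : k) ^ n)) :
    ∃ (b : Module.Basis (Option ℕ+) k (H2 (f l) (g l))) (D : Option ℕ+ → Der (f l)),
      (∀ i, b i = derClass (f l) (g l) (D i, 0)) ∧
      (D none).1 (xB k) = xA l ∧
      (∀ N : ℕ+, (D (some N)).1 (xB k) = invXSubOne l ^ (N : ℕ)) ∧
      Function.Injective (regularToH2 l) ∧
      LinearMap.range (regularToH2 l) = Submodule.span k {b none} := by
  have hD (i : Option ℕ+) :
      ((derBA (f l)).symm (representative l i)).1 (xB k) = representative l i :=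
    (derBA (f l)).apply_symm_apply _
  have hb (i : Option ℕ+) : (quotientBasis hpow).map (h2Equiv l).symm i =
      derClass (f l) (g l) ((derBA (f l)).symm (representative l i), 0) := by
    rw [Module.Basis.map_apply, LinearEquiv.symm_apply_eq, h2Equiv_derClass, quotientBasis_apply,
      evalDiff_apply, hD]
    simp
  refine ⟨(quotientBasis hpow).map (h2Equiv l).symm,
    fun i => (derBA (f l)).symm (representative l i), hb, hD none, fun N => hD (some N),
    regularToH2_injective hpow, ?_⟩
  rw [range_regularToH2 hpow, hb]
  rfl

end Quotient

end FourPunctured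

theorem theorem1 {k : Type*} [CommRing k] (l : kˣ) (hl : l ≠ 1) :
    -- every class is represented by a pair of derivations, and
    -- `(Γ^f, Γ^g) ↦ Γ^f(x) - l Γ^g(x)` identifies `H²` with a quotient of `A`
    Function.Surjective
      (DiagramCohomology.derClass (FourPunctured.f l) (FourPunctured.g l)) ∧
    (∃ e : DiagramCohomology.H2 (FourPunctured.f l) (FourPunctured.g l) ≃ₗ[k]
        (FourPunctured.A l ⧸ FourPunctured.twistedDifferences l),
      ∀ (Γf : DiagramCohomology.Der (FourPunctured.f l))
        (Γg : DiagramCohomology.Der (FourPunctured.g l)),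
        e (DiagramCohomology.derClass (FourPunctured.f l) (FourPunctured.g l) (Γf, Γg)) =
          Submodule.Quotient.mk
            (Γf.1 (FourPunctured.xB k) - (l : k) • Γg.1 (FourPunctured.xB k))) ∧
    -- `H²` is not finitely generated
    ¬ Module.Finite k (DiagramCohomology.H2 (FourPunctured.f l) (FourPunctured.g l)) ∧
    ((∀ n : ℕ, 0 < n → IsUnit (1 - (l : k) ^ n)) →
      -- the classes of `x` and of the `1/(x-1)^N`, `N > 0`, are a basis
      ∃ (b : Module.Basis (Option ℕ+) k
            (DiagramCohomology.H2 (FourPunctured.f l) (FourPunctured.g l)))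
        (D : Option ℕ+ → DiagramCohomology.Der (FourPunctured.f l)),
        (∀ i, b i =
          DiagramCohomology.derClass (FourPunctured.f l) (FourPunctured.g l) (D i, 0)) ∧
        (D none).1 (FourPunctured.xB k) = FourPunctured.xA l ∧
        (∀ N : ℕ+, (D (some N)).1 (FourPunctured.xB k) =
          FourPunctured.invXSubOne l ^ (N : ℕ)) ∧
        -- the cohomology with regular derivations is the part spanned by the class of `x`
        Function.Injective (FourPunctured.regularToH2 l) ∧
        LinearMap.range (FourPunctured.regularToH2 l) = Submodule.span k {b none}) := by
  refine ⟨FourPunctured.derClass_surjective l,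
    ⟨FourPunctured.h2Equiv l, fun Γf Γg => FourPunctured.h2Equiv_derClass l (Γf, Γg)⟩,
    fun h => ?_, FourPunctured.exists_basis⟩
  exact FourPunctured.not_finite_quotient l hl (Module.Finite.equiv (FourPunctured.h2Equiv l))
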